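/- Let $K$ be a compact metric space, $N\ge 2$, and let $\gamma=(\gamma_1,\dots,\gamma_N)$ be a self-similar map on $K$: each $\gamma_i:K\to K$ is a proper contraction (there are $0<c_i'\le c_i<1$ with $c_i'd(x,y)\le d(\gamma_i(x),\gamma_i(y))\le c_i d(x,y)$ for all $x,y$) and $K=\bigcup_{i=1}^N\gamma_i(K)$. For a finite family $\sigma=(\sigma_i)_{i\in I}$ of maps $K\to K$ put $B_\sigma=\{b\in K: b=\sigma_i(a)=\sigma_j(a)\text{ for some }a\in K,\ i\ne j\}$ and $C_\sigma=\{a\in K:\sigma_i(a)=\sigma_j(a)\text{ for some }i\neq j\}$, and let $P_\gamma=\{a\in K:\exists k\ge1,\ \exists (j_1,\dots,j_k)\in\{1,\dots,N\}^k,\ \gamma_{j_1}\circ\cdots\circ\gamma_{j_k}(a)\in B_\gamma\}$. Suppose that $\gamma$ satisfies Assumption B: (1) there is a continuous $h:K\to K$ with $h(\gamma_j(y))=y$ for all $j$ and $y$; (2) $B_\gamma$ is finite; (3) $B_\gamma\cap P_\gamma=\emptyset$. Let $A=C(K)$, $\mathcal C_\gamma=\{(\gamma_j(y),y):1\le j\le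 N,\ y\in K\}$, and let $X_\gamma=C(\mathcal C_\gamma)$ be the $C^*$-correspondence over $A$ with $(a\cdot f\cdot b)(x,y)=a(x)f(x,y)b(y)$ and $(f|g)_A(y)=\sum_{j=1}^N\overline{f(\gamma_j(y),y)}\,g(\gamma_j(y),y)$. Let $X_\gamma^{\otimes n}$ be its $n$-fold inner tensor product over $A$, a Hilbert $A$-module ($X_\gamma^{\otimes 0}=A$). For a Hilbert $A$-module $X$, let $\mathcal L(X)$ be the algebra of adjointable operators on $X$, let $\theta_{x,y}(z)=x(y|z)_A$, let $\mathcal K_0(X)\subset\mathcal L(X)$ be the set of finite sums of operators $\theta_{x,y}$ with $x,y\in X$, and let $\mathcal K(X)$ be the $C^*$-algebra generated by the $\theta_{x,y}$. For ${\bf i}=(i_1,\dots,i_n)\in\{1,\dots,N\}^n$ put $\gamma_{\bf i}=\gamma_{i_n}\circ\cdots\circ\gamma_{i_1}$, and let $\gamma^n=(\gamma_{\bf i})_{\bf i}$. Let $D^{\gamma^n}$ be the set of all matrices $[a_{{\bf i}{\bf j}}]\in M_{N^n}(A)$, with rows and columns indexed by $\{1,\dots,N\}^n$, such that for all $c\in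 C_{\gamma^n}$ and $b\in B_{\gamma^n}$ with $h^n(b)=c$, all ${\bf j},{\bf j}'$ with $\gamma_{\bf j}(c)=\gamma_{{\bf j}'}(c)=b$, and all ${\bf i}$, $$a_{{\bf j}{\bf i}}(c)=a_{{\bf j}'{\bf i}}(c),\qquad a_{{\bf i}{\bf j}}(c)=a_{{\bf i}{\bf j}'}(c).$$ Then for every $n\ge 0$: $\mathcal K_0(X_\gamma^{\otimes n})=\mathcal K(X_\gamma^{\otimes n})$, the set $D^{\gamma^n}$ is a closed $*$-subalgebra of $M_{N^n}(A)$, and $\mathcal K(X_\gamma^{\otimes n})$ is $*$-isomorphic to $D^{\gamma^n}$. -/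

import Mathlib

open scoped ComplexOrder TensorProduct

universe u

noncomputable section

/-! ### Self-similar maps and Assumption B -/

section SelfSimilar

variable {K : Type u} {ι : Type*}

/-- `f` is a proper contraction: `c' d(x,y) ≤ d(f x, f y) ≤ c d(x,y)` with `0 < c' ≤ c < 1`. -/
def IsProperContraction [MetricSpace K] (f : K → K) : Prop :=
  ∃ c' c : ℝ, 0 < c' ∧ c' ≤ c ∧ c < 1 ∧
    ∀ x y, c' * dist x y ≤ dist (f x) (f y) ∧ dist (f x) (f y) ≤ c * dist x y

/-- The family `γ` of proper contractions is a self-similar map on `K`: `K = ⋃ i, γ i (K)`. -/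
structure IsSelfSimilar [MetricSpace K] (γ : ι → C(K, K)) : Prop where
  isProperContraction : ∀ i, IsProperContraction (γ i)
  iUnion_range_eq : ⋃ i, Set.range (γ i) = Set.univ

/-- The branch set `B_γ`. -/
def branchSet (γ : ι → K → K) : Set K :=
  {b | ∃ a, ∃ i j, i ≠ j ∧ b = γ i a ∧ b = γ j a}

/-- The branch value set `C_γ`. -/
def branchValueSet (γ : ι → K → K) : Set K :=
  {a | ∃ i j, i ≠ j ∧ γ i a = γ j a}

/-- The composition `γ_𝐢 = γ_{i_n} ∘ ⋯ ∘ γ_{i_1}` for a word `𝐢 = (i_1, …, i_n)`. The family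
`iterFamily γ n`, indexed by the words of length `n`, is `γ^n`. -/
def iterFamily (γ : ι → K → K) : (n : ℕ) → (Fin n → ι) → K → K
  | 0, _ => id
  | n + 1, i => γ (i (Fin.last n)) ∘ iterFamily γ n (Fin.init i)

/-- The postcritical set `P_γ`. -/
def postcriticalSet (γ : ι → K → K) : Set K :=
  {a | ∃ k : ℕ, 1 ≤ k ∧ ∃ j : Fin k → ι, iterFamily γ k j a ∈ branchSet γ}

/-- Assumption B for the family `γ`, with `h` the continuous map of its first clause. -/
structure AssumptionB [TopologicalSpace K] (γ : ι → K → K) (h : K → K) : Prop where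
  continuous : Continuous h
  leftInverse : ∀ j y, h (γ j y) = y
  finite_branchSet : (branchSet γ).Finite
  disjoint : branchSet γ ∩ postcriticalSet γ = ∅

end SelfSimilar

/-! ### The algebra `D^γ` of matrix valued functions -/

section DegenerateAlgebra

variable {K : Type u} [TopologicalSpace K] [CompactSpace K] {ι : Type*} [Fintype ι]

/-- The subalgebra `D^γ` of `M_ι(C(K))`: for `c ∈ C_γ` and `b ∈ B_γ` with `h b = c`, all rows of
`a(c)` with an index in `{j | b = γ_j(c)}` agree, and so do all columns with such an index. -/
def degenerateAlgebra (γ : ι → K → K) (h : K → K) :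
    NonUnitalStarSubalgebra ℂ (CStarMatrix ι ι C(K, ℂ)) where
  carrier := {a | ∀ c ∈ branchValueSet γ, ∀ b ∈ branchSet γ, h b = c →
    ∀ j j' : ι, b = γ j c → b = γ j' c →
      ∀ i : ι, a j i c = a j' i c ∧ a i j c = a i j' c}
  add_mem' {x y} hx hy c hc b hb hbc j j' hj hj' i := by
    have h1 := hx c hc b hb hbc j j' hj hj' i
    have h2 := hy c hc b hb hbc j j' hj hj' i
    simp [CStarMatrix.add_apply, h1.1, h1.2, h2.1, h2.2]
  zero_mem' c hc b hb hbc j j' hj hj' i := by simp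
  mul_mem' {x y} hx hy c hc b hb hbc j j' hj hj' i := by
    have h1 := fun k => (hx c hc b hb hbc j j' hj hj' k).1
    have h2 := fun k => (hy c hc b hb hbc j j' hj hj' k).2
    simp [CStarMatrix.mul_apply, h1, h2]
  smul_mem' r x hx c hc b hb hbc j j' hj hj' i := by
    have h1 := hx c hc b hb hbc j j' hj hj' i
    simp [h1.1, h1.2]
  star_mem' {x} hx c hc b hb hbc j j' hj hj' i := by
    have h1 := hx c hc b hb hbc j j' hj hj' i
    simp [CStarMatrix.star_apply, h1.1, h1.2]

end DegenerateAlgebra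

/-! ### Adjointable and compact operators on a Hilbert module -/

section Adjointable

set_option linter.unusedSectionVars false

variable (A : Type*) (E : Type*) [CommCStarAlgebra A] [PartialOrder A] [StarOrderedRing A]
  [NormedAddCommGroup E] [NormedSpace ℂ E] [Module A E] [CStarModule A E]

/-- The adjointable operators `L(E)` on a Hilbert `A`-module `E`, as a subalgebra of the bounded
operators on `E`. -/
def adjointableOperators : Subalgebra ℂ (E →L[ℂ] E) where
  carrier := {T | ∃ S : E →L[ℂ] E, ∀ x y, inner A (T x) y = inner A x (S y)}
  mul_mem' := by
    rintro T T' ⟨S, hS⟩ ⟨S', hS'⟩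
    exact ⟨S' * S, fun x y => by simp [hS, hS']⟩
  add_mem' := by
    rintro T T' ⟨S, hS⟩ ⟨S', hS'⟩
    exact ⟨S + S', fun x y => by simp [hS, hS']⟩
  algebraMap_mem' r := by
    refine ⟨algebraMap ℂ _ (star r), fun x y => ?_⟩
    simp [Algebra.algebraMap_eq_smul_one]

variable {A E}

theorem CStarModule.eq_of_inner_left {x y : E} (hxy : ∀ z, inner A z x = inner A z y) :
    x = y := by
  have : inner A (x - y) (x - y) = 0 := by
    rw [CStarModule.inner_sub_right, hxy, sub_self]
  exact sub_eq_zero.1 (CStarModule.inner_self.1 this)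

theorem adjointableOperators_ext {S S' T : adjointableOperators A E}
    (hS : ∀ x y, inner A (T.1 x) y = inner A x (S.1 y))
    (hS' : ∀ x y, inner A (T.1 x) y = inner A x (S'.1 y)) : S = S' :=
  Subtype.ext <| ContinuousLinearMap.ext fun y => CStarModule.eq_of_inner_left (A := A)
    fun x => by rw [← hS, ← hS']

/-- The involution of `L(E)` is the adjoint. -/
instance : Star (adjointableOperators A E) where
  star T := ⟨T.2.choose, T.1, fun x y => by
    rw [← CStarModule.star_inner, ← T.2.choose_spec, CStarModule.star_inner]⟩

theorem inner_star_right (T : adjointableOperators A E) (x y : E) :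
    inner A (T.1 x) y = inner A x ((star T).1 y) :=
  T.2.choose_spec x y

theorem inner_star_left (T : adjointableOperators A E) (x y : E) :
    inner A ((star T).1 x) y = inner A x (T.1 y) := by
  rw [← CStarModule.star_inner, ← inner_star_right, CStarModule.star_inner]

instance : StarRing (adjointableOperators A E) where
  star_involutive T := adjointableOperators_ext (T := star T)
    (fun x y => inner_star_right _ x y) (fun x y => inner_star_left _ x y)
  star_mul S T := adjointableOperators_ext (T := S * T)
    (fun x y => inner_star_right _ x y)
    (fun x y => by simp [inner_star_right])
  star_add S T := adjointableOperators_ext (T := S + T)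
    (fun x y => inner_star_right _ x y)
    (fun x y => by simp [inner_star_right])

instance : StarModule ℂ (adjointableOperators A E) where
  star_smul r T := adjointableOperators_ext (T := r • T)
    (fun x y => inner_star_right _ x y)
    (fun x y => by simp [inner_star_right])

instance : CStarRing (adjointableOperators A E) where
  norm_mul_self_le T := by
    have key : ‖T.1‖ ≤ √‖star T * T‖ := by
      refine T.1.opNorm_le_bound (Real.sqrt_nonneg _) fun x => ?_
      have h1 : ‖T.1 x‖ ^ 2 ≤ ‖star T * T‖ * ‖x‖ ^ 2 := by
        rw [CStarModule.norm_sq_eq A, inner_star_right]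
        calc _ ≤ ‖x‖ * ‖(star T * T).1 x‖ := CStarModule.norm_inner_le E
          _ ≤ ‖x‖ * (‖star T * T‖ * ‖x‖) := by
            gcongr
            exact (star T * T).1.le_opNorm x
          _ = _ := by ring
      have h2 := Real.sqrt_le_sqrt h1
      rwa [Real.sqrt_sq (norm_nonneg _), Real.sqrt_mul (norm_nonneg (star T * T)),
        Real.sqrt_sq (norm_nonneg _)] at h2
    have h3 : ‖T‖ ≤ √‖star T * T‖ := key
    calc ‖T‖ * ‖T‖ ≤ √‖star T * T‖ * √‖star T * T‖ := by gcongr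
      _ = _ := Real.mul_self_sqrt (norm_nonneg _)

variable (A) in
/-- The bounded operator `z ↦ x · (y|z)_A`. -/
def rankOneCLM (x y : E) : E →L[ℂ] E :=
  LinearMap.mkContinuous
    { toFun := fun z => inner A y z • x
      map_add' := fun z w => by rw [CStarModule.inner_add_right, add_smul]
      map_smul' := fun r z => CStarModule.eq_of_inner_left (A := A) fun w => by simp }
    (‖y‖ * ‖x‖) fun z => by
      have h1 : ∀ a : A, ‖a • x‖ ≤ ‖a‖ * ‖x‖ := fun a => by
        rw [← pow_le_pow_iff_left₀ (norm_nonneg _) (by positivity) two_ne_zero, mul_pow,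
          CStarModule.norm_sq_eq A (E := E), CStarModule.norm_sq_eq A (E := E),
          CStarModule.inner_op_smul_right,
          CStarModule.inner_op_smul_left]
        calc _ ≤ ‖a‖ * (‖inner A x x‖ * ‖star a‖) :=
              (norm_mul_le _ _).trans (by gcongr; exact norm_mul_le _ _)
          _ = _ := by rw [norm_star]; ring
      calc _ ≤ ‖inner A y z‖ * ‖x‖ := h1 _
        _ ≤ (‖y‖ * ‖z‖) * ‖x‖ := by gcongr; exact CStarModule.norm_inner_le E
        _ = _ := by ring

variable (A E) in
/-- The C⋆-algebra `L(E)` of adjointable operators on `E`, with the operator norm and with the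
adjoint as involution. -/
def AdjointableOp : Type _ := adjointableOperators A E

instance : NormedRing (AdjointableOp A E) := inferInstanceAs (NormedRing (adjointableOperators A E))

instance : NormedAlgebra ℂ (AdjointableOp A E) :=
  inferInstanceAs (NormedAlgebra ℂ (adjointableOperators A E))

instance : StarRing (AdjointableOp A E) := inferInstanceAs (StarRing (adjointableOperators A E))

instance : StarModule ℂ (AdjointableOp A E) :=
  inferInstanceAs (StarModule ℂ (adjointableOperators A E))

instance : CStarRing (AdjointableOp A E) := inferInstanceAs (CStarRing (adjointableOperators A E))

variable (A) in
/-- The rank one operator `θ_{x,y}(z) = x · (y|z)_A`, as an element of `L(E)`. -/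
def rankOne (x y : E) : AdjointableOp A E :=
  ⟨rankOneCLM A x y, rankOneCLM A y x, fun z w => by
    change inner A (inner A y z • x) w = inner A z (inner A x w • y)
    simp⟩

variable (A E) in
/-- `K₀(E)`: the finite sums of rank one operators. -/
def finiteRankOperators : Set (AdjointableOp A E) :=
  {T | ∃ (m : ℕ) (x y : Fin m → E), T = ∑ i, rankOne A (x i) (y i)}

variable (A E) in
/-- `K(E)`: the C⋆-algebra (closed ⋆-subalgebra of `L(E)`) generated by the rank one operators. -/
def compactOperators : NonUnitalStarSubalgebra ℂ (AdjointableOp A E) :=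
  (NonUnitalStarAlgebra.adjoin ℂ
    {T : AdjointableOp A E | ∃ x y : E, T = rankOne A x y}).topologicalClosure

end Adjointable

/-! ### Pre-Hilbert `C(K)`-modules and their completions -/

section PreHilbert

set_option linter.unusedSectionVars false

variable (K : Type u) [TopologicalSpace K] [CompactSpace K]

/-- A (right) semi-inner product module over `A = C(K)`: a complex vector space with an action
`act a x = x · a` of `A` and a positive semidefinite `A`-valued form, conjugate linear in the first
and linear in the second variable. -/
structure PreHilbertModule where
  carrier : Type u
  [addCommGroup : AddCommGroup carrier]
  [module : Module ℂ carrier]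
  act : C(K, ℂ) →ₐ[ℂ] Module.End ℂ carrier
  form : carrier →ₗ⋆[ℂ] carrier →ₗ[ℂ] C(K, ℂ)
  star_form : ∀ x y, star (form x y) = form y x
  form_nonneg : ∀ x k, 0 ≤ form x x k
  form_act : ∀ a x y, form x (act a y) = form x y * a

namespace PreHilbertModule

attribute [instance] addCommGroup module

variable {K} (P : PreHilbertModule K)

instance : Module C(K, ℂ) P.carrier := Module.compHom P.carrier P.act.toRingHom

theorem smul_def (a : C(K, ℂ)) (x : P.carrier) : a • x = P.act a x := rfl

instance : Inner C(K, ℂ) P.carrier := ⟨fun x y => P.form x y⟩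

theorem inner_def (x y : P.carrier) : inner C(K, ℂ) x y = P.form x y := rfl

/-- The semi-norm `‖(x|x)_A‖^{1/2}`. -/
instance : Norm P.carrier := ⟨fun x => √‖P.form x x‖⟩

theorem norm_def (x : P.carrier) : ‖x‖ = √‖P.form x x‖ := rfl

theorem norm_sq (x : P.carrier) : ‖x‖ ^ 2 = ‖P.form x x‖ := by
  rw [norm_def, Real.sq_sqrt (_root_.norm_nonneg _)]

theorem norm_form_le (x y : P.carrier) : ‖P.form x y‖ ≤ ‖x‖ * ‖y‖ := by
  have hx : 0 ≤ ‖x‖ := Real.sqrt_nonneg _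
  have hy : 0 ≤ ‖y‖ := Real.sqrt_nonneg _
  have hstar : ∀ (x y : P.carrier) (k : K), star (P.form x y k) = P.form y x k := fun x y k => by
    rw [← P.star_form x y]; rfl
  refine (ContinuousMap.norm_le _ (mul_nonneg hx hy)).2 fun k => ?_
  let _ : PreInnerProductSpace.Core ℂ P.carrier :=
    { inner := fun x y => P.form x y k
      conj_inner_symm := fun x y => hstar y x k
      re_inner_nonneg := fun x => (Complex.nonneg_iff.1 (P.form_nonneg x k)).1
      add_left := fun x y z => by simp
      smul_left := fun x y r => by simp }
  have h : ‖P.form x y k‖ * ‖P.form y x k‖ ≤ (P.form x x k).re * (P.form y y k).re :=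
    InnerProductSpace.Core.inner_mul_inner_self_le (𝕜 := ℂ) x y
  have h' : ‖P.form y x k‖ = ‖P.form x y k‖ := by rw [← hstar x y k, norm_star]
  have hre : ∀ z : P.carrier, (P.form z z k).re ≤ ‖z‖ ^ 2 := fun z =>
    (Complex.re_le_norm _).trans (by rw [norm_sq]; exact (P.form z z).norm_coe_le_norm k)
  rw [h'] at h
  rw [← pow_le_pow_iff_left₀ (_root_.norm_nonneg _) (mul_nonneg hx hy) two_ne_zero, mul_pow, sq]
  exact h.trans (mul_le_mul (hre x) (hre y) (Complex.nonneg_iff.1 (P.form_nonneg y k)).1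
    (sq_nonneg _))

theorem seminormCore : SeminormedSpace.Core ℂ P.carrier where
  norm_nonneg x := Real.sqrt_nonneg _
  norm_smul c x := by
    have : P.form (c • x) (c • x) = (star c * c) • P.form x x := by
      rw [map_smul, map_smulₛₗ, LinearMap.smul_apply, smul_smul, mul_comm]; rfl
    rw [norm_def, norm_def, this, norm_smul, norm_mul, norm_star,
      Real.sqrt_mul (mul_nonneg (_root_.norm_nonneg _) (_root_.norm_nonneg _)),
      Real.sqrt_mul_self (_root_.norm_nonneg _)]
  norm_triangle x y := by
    have hx : 0 ≤ ‖x‖ := Real.sqrt_nonneg _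
    have hy : 0 ≤ ‖y‖ := Real.sqrt_nonneg _
    refine (pow_le_pow_iff_left₀ (Real.sqrt_nonneg _) (add_nonneg hx hy) two_ne_zero).1 ?_
    change ‖x + y‖ ^ 2 ≤ _
    rw [norm_sq]
    have : P.form (x + y) (x + y) = P.form x x + P.form x y + (P.form y x + P.form y y) := by
      simp only [map_add, LinearMap.add_apply]; abel
    calc _ ≤ ‖P.form x x‖ + ‖P.form x y‖ + (‖P.form y x‖ + ‖P.form y y‖) := by
          rw [this]
          exact (norm_add_le _ _).trans (add_le_add (norm_add_le _ _) (norm_add_le _ _))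
      _ ≤ ‖x‖ ^ 2 + ‖x‖ * ‖y‖ + (‖y‖ * ‖x‖ + ‖y‖ ^ 2) :=
          add_le_add (add_le_add (P.norm_sq x).ge (P.norm_form_le x y))
            (add_le_add (P.norm_form_le y x) (P.norm_sq y).ge)
      _ = _ := by ring

instance : SeminormedAddCommGroup P.carrier := SeminormedAddCommGroup.ofCore P.seminormCore

instance : NormedSpace ℂ P.carrier where
  norm_smul_le c x := (P.seminormCore.norm_smul c x).le

theorem form_smul_left (a : C(K, ℂ)) (x y : P.carrier) :
    P.form (P.act a x) y = star a * P.form x y := by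
  rw [← P.star_form, form_act, star_mul, P.star_form]

theorem norm_act_le (a : C(K, ℂ)) (x : P.carrier) : ‖a • x‖ ≤ ‖a‖ * ‖x‖ := by
  rw [← pow_le_pow_iff_left₀ (_root_.norm_nonneg _) (by positivity) two_ne_zero, mul_pow, norm_sq,
    norm_sq, smul_def, form_act, form_smul_left]
  calc _ ≤ ‖star a‖ * ‖P.form x x‖ * ‖a‖ :=
        (norm_mul_le _ _).trans (by gcongr; exact norm_mul_le _ _)
    _ = _ := by rw [norm_star]; ring

instance : UniformContinuousConstSMul C(K, ℂ) P.carrier :=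
  ⟨fun a => by
    have : LipschitzWith ‖a‖₊ (fun x : P.carrier => a • x) :=
      LipschitzWith.of_dist_le_mul fun x y => by
        rw [dist_eq_norm, dist_eq_norm, ← smul_sub]
        exact P.norm_act_le a (x - y)
    exact this.uniformContinuous⟩

theorem continuous_inner :
    Continuous (fun p : P.carrier × P.carrier => inner C(K, ℂ) p.1 p.2) := by
  have : Continuous fun p : P.carrier × P.carrier =>
      LinearMap.mkContinuous₂ P.form 1 (fun x y => by simpa using P.norm_form_le x y) p.1 p.2 := by
    fun_prop
  exact this

/-- The Hilbert `C(K)`-module obtained from `P`: the Hausdorff completion (null vectors are divided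
out). Its `C(K)`-action and its inner product are the continuous extensions of those of `P`. -/
abbrev Completion : Type u := UniformSpace.Completion P.carrier

open UniformSpace in
theorem inner_coe (x y : P.carrier) :
    inner C(K, ℂ) (x : P.Completion) (y : P.Completion) = P.form x y :=
  (Completion.isDenseInducing_coe.prodMap Completion.isDenseInducing_coe).extend_eq
    P.continuous_inner (x, y)

open UniformSpace Function in
theorem continuous_inner_completion :
    Continuous (fun p : P.Completion × P.Completion => inner C(K, ℂ) p.1 p.2) := by
  let inner' : P.carrier →+ P.carrier →+ C(K, ℂ) :=
    { toFun := fun x => (P.form x).toAddMonoidHom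
      map_zero' := by ext x; simp
      map_add' := fun x y => by ext z; simp }
  have : Continuous fun p : P.carrier × P.carrier => inner' p.1 p.2 := P.continuous_inner
  exact (Completion.isDenseInducing_toCompl P.carrier).extend_Z_bilin
    (Completion.isDenseInducing_toCompl P.carrier) this

theorem continuous_inner_completion' {α : Type*} [TopologicalSpace α] {f g : α → P.Completion}
    (hf : Continuous f) (hg : Continuous g) : Continuous fun x => inner C(K, ℂ) (f x) (g x) :=
  P.continuous_inner_completion.comp (hf.prodMk hg)

open UniformSpace in
theorem norm_sq_completion (x : P.Completion) : ‖x‖ ^ 2 = ‖inner C(K, ℂ) x x‖ :=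
  Completion.induction_on x
    (isClosed_eq (by fun_prop)
      (P.continuous_inner_completion' continuous_id continuous_id).norm)
    fun a => by rw [Completion.norm_coe, inner_coe, norm_sq]

open UniformSpace in
instance : CStarModule C(K, ℂ) P.Completion where
  inner_add_right {x y z} := Completion.induction_on₃ x y z
    (isClosed_eq (P.continuous_inner_completion' (by fun_prop) (by fun_prop))
      ((P.continuous_inner_completion' (by fun_prop) (by fun_prop)).add
        (P.continuous_inner_completion' (by fun_prop) (by fun_prop))))
    fun a b c => by simp only [← Completion.coe_add, inner_coe, map_add]
  inner_self_nonneg {x} := Completion.induction_on x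
    (isClosed_le continuous_const (P.continuous_inner_completion' (by fun_prop) (by fun_prop)))
    fun a => by
      rw [inner_coe]
      exact fun k => P.form_nonneg a k
  inner_self {x} := by
    have : ‖x‖ ^ 2 = ‖inner C(K, ℂ) x x‖ := P.norm_sq_completion x
    rw [← norm_eq_zero, ← this, sq_eq_zero_iff, norm_eq_zero]
  inner_op_smul_right {a x y} := Completion.induction_on₂ x y
    (isClosed_eq (P.continuous_inner_completion' continuous_fst
        ((uniformContinuous_const_smul a).continuous.comp continuous_snd))
      (continuous_const.mul (P.continuous_inner_completion' (by fun_prop) (by fun_prop))))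
    fun x y => by rw [← Completion.coe_smul, inner_coe, inner_coe, smul_def, form_act, mul_comm]
  inner_smul_right_complex {r x y} := Completion.induction_on₂ x y
    (isClosed_eq (P.continuous_inner_completion' continuous_fst
        ((uniformContinuous_const_smul r).continuous.comp continuous_snd))
      ((continuous_const_smul r).comp
        (P.continuous_inner_completion' continuous_fst continuous_snd)))
    fun x y => by rw [← Completion.coe_smul, inner_coe, inner_coe, map_smul]
  star_inner x y := Completion.induction_on₂ x y
    (isClosed_eq
      (continuous_star.comp (P.continuous_inner_completion' continuous_fst continuous_snd))
      (P.continuous_inner_completion' continuous_snd continuous_fst))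
    fun x y => by rw [inner_coe, inner_coe, P.star_form]
  norm_eq_sqrt_norm_inner_self x := by
    rw [← P.norm_sq_completion x, Real.sqrt_sq (_root_.norm_nonneg _)]

end PreHilbertModule

end PreHilbert

/-! ### The correspondence `X_γ` and its tensor powers -/

section Correspondence

variable {K : Type u} [TopologicalSpace K] [CompactSpace K] {ι : Type*} [Fintype ι]

/-- The set `𝒞_γ = {(γ_j(y), y)}`. -/
def cograph (γ : ι → C(K, K)) : Set (K × K) := {p | ∃ j y, p = (γ j y, y)}

/-- The map `y ↦ (γ_j(y), y)` from `K` to `𝒞_γ`. -/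
def cographMk (γ : ι → C(K, K)) (j : ι) : C(K, cograph γ) where
  toFun y := ⟨(γ j y, y), j, y, rfl⟩

/-- The first coordinate `𝒞_γ → K`. -/
def cographFst (γ : ι → C(K, K)) : C(cograph γ, K) where
  toFun p := p.1.1

/-- The second coordinate `𝒞_γ → K`. -/
def cographSnd (γ : ι → C(K, K)) : C(cograph γ, K) where
  toFun p := p.1.2

/-- The left action `(a · f)(x, y) = a(x) f(x, y)` of `C(K)` on `X_γ = C(𝒞_γ)`. -/
def leftAct (γ : ι → C(K, K)) : C(K, ℂ) →ₐ[ℂ] Module.End ℂ C(cograph γ, ℂ) :=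
  (Algebra.lmul ℂ C(cograph γ, ℂ)).comp (ContinuousMap.compRightAlgHom ℂ ℂ (cographFst γ))

/-- The right action `(f · a)(x, y) = f(x, y) a(y)` of `C(K)` on `X_γ = C(𝒞_γ)`. -/
def rightAct (γ : ι → C(K, K)) : C(K, ℂ) →ₐ[ℂ] Module.End ℂ C(cograph γ, ℂ) :=
  (Algebra.lmul ℂ C(cograph γ, ℂ)).comp (ContinuousMap.compRightAlgHom ℂ ℂ (cographSnd γ))

/-- The form `(f|g)_A(y) = ∑ j, conj (f(γ_j(y), y)) g(γ_j(y), y)` on `X_γ = C(𝒞_γ)`. -/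
def selfSimilarForm (γ : ι → C(K, K)) :
    C(cograph γ, ℂ) →ₗ⋆[ℂ] C(cograph γ, ℂ) →ₗ[ℂ] C(K, ℂ) :=
  LinearMap.mk₂'ₛₗ (starRingEnd ℂ) (RingHom.id ℂ)
    (fun f g => ∑ j, star (f.comp (cographMk γ j)) * g.comp (cographMk γ j))
    (fun f f' g => by ext; simp [add_mul, Finset.sum_add_distrib])
    (fun c f g => by ext; simp [Finset.mul_sum])
    (fun f g g' => by ext; simp [mul_add, Finset.sum_add_distrib])
    (fun c f g => by ext; simp [Finset.mul_sum])

theorem selfSimilarForm_apply (γ : ι → C(K, K)) (f g : C(cograph γ, ℂ)) (y : K) :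
    selfSimilarForm γ f g y = ∑ j, star (f (cographMk γ j y)) * g (cographMk γ j y) := by
  simp [selfSimilarForm]

/-- `X_γ = C(𝒞_γ)` as a right module over `C(K)` with its `C(K)`-valued inner product. -/
def selfSimilarModule (γ : ι → C(K, K)) : PreHilbertModule K where
  carrier := C(cograph γ, ℂ)
  act := rightAct γ
  form := selfSimilarForm γ
  star_form f g := by
    ext y
    simp [selfSimilarForm_apply, mul_comm]
  form_nonneg f y := by
    rw [selfSimilarForm_apply]
    exact Finset.sum_nonneg fun j _ => star_mul_self_nonneg _
  form_act a f g := by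
    ext y
    simp [selfSimilarForm_apply, Finset.mul_sum, rightAct, cographMk, cographSnd, mul_comm,
      mul_left_comm]

variable (K) in
/-- `C(K)` as a module over itself, with `(a|b)_A = a⋆ b`. -/
def coefficientModule : PreHilbertModule K where
  carrier := C(K, ℂ)
  act := Algebra.lmul ℂ C(K, ℂ)
  form := LinearMap.mk₂'ₛₗ (starRingEnd ℂ) (RingHom.id ℂ) (fun a b => star a * b)
    (fun f f' g => by ext; simp [add_mul])
    (fun c f g => by ext; simp)
    (fun f g g' => by ext; simp [mul_add])
    (fun c f g => by ext; simp)
  star_form f g := by ext y; simp [mul_comm]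
  form_nonneg f y := by
    change 0 ≤ star (f y) * f y
    exact star_mul_self_nonneg _
  form_act a f g := by ext y; simp; ring

/-- The form on `P ⊗ X_γ` with `(s ⊗ f | t ⊗ g)_A = (f | (s|t)_A · g)_A`. -/
def tensorForm (P : PreHilbertModule K) (γ : ι → C(K, K)) :
    (P.carrier ⊗[ℂ] C(cograph γ, ℂ)) →ₗ⋆[ℂ] (P.carrier ⊗[ℂ] C(cograph γ, ℂ)) →ₗ[ℂ] C(K, ℂ) :=
  TensorProduct.lift <| LinearMap.mk₂'ₛₗ (starRingEnd ℂ) (starRingEnd ℂ)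
    (fun s f => TensorProduct.lift <| LinearMap.mk₂ ℂ
      (fun t g => selfSimilarForm γ f (leftAct γ (P.form s t) g))
      (fun t t' g => by simp only [map_add, LinearMap.add_apply])
      (fun c t g => by simp only [map_smul, LinearMap.smul_apply])
      (fun t g g' => by simp only [map_add])
      (fun c t g => by simp only [map_smul]))
    (fun s s' f => TensorProduct.ext' fun t g => by
      simp only [TensorProduct.lift.tmul, LinearMap.mk₂_apply, map_add, LinearMap.add_apply])
    (fun c s f => TensorProduct.ext' fun t g => by
      simp only [TensorProduct.lift.tmul, LinearMap.mk₂_apply, map_smulₛₗ,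
        LinearMap.smul_apply, RingHom.id_apply])
    (fun s f f' => TensorProduct.ext' fun t g => by
      simp only [TensorProduct.lift.tmul, LinearMap.mk₂_apply, map_add, LinearMap.add_apply])
    (fun c s f => TensorProduct.ext' fun t g => by
      simp only [TensorProduct.lift.tmul, LinearMap.mk₂_apply, map_smulₛₗ,
        LinearMap.smul_apply])

theorem tensorForm_tmul (P : PreHilbertModule K) (γ : ι → C(K, K)) (s t : P.carrier)
    (f g : C(cograph γ, ℂ)) :
    tensorForm P γ (s ⊗ₜ f) (t ⊗ₜ g) = selfSimilarForm γ f (leftAct γ (P.form s t) g) := rfl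

/-- The slice `s ⊗ f ↦ f(γ_j(y), y) s`. -/
def tensorSlice (P : PreHilbertModule K) (γ : ι → C(K, K)) (j : ι) (y : K) :
    (P.carrier ⊗[ℂ] C(cograph γ, ℂ)) →ₗ[ℂ] P.carrier :=
  TensorProduct.lift <| LinearMap.mk₂ ℂ (fun s f => f (cographMk γ j y) • s)
    (fun s s' f => by rw [smul_add])
    (fun c s f => by rw [smul_comm])
    (fun s f f' => by rw [ContinuousMap.add_apply, add_smul])
    (fun c s f => by rw [ContinuousMap.smul_apply, smul_eq_mul, mul_smul])

theorem tensorForm_apply (P : PreHilbertModule K) (γ : ι → C(K, K))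
    (x z : P.carrier ⊗[ℂ] C(cograph γ, ℂ)) (y : K) :
    tensorForm P γ x z y =
      ∑ j, P.form (tensorSlice P γ j y x) (tensorSlice P γ j y z) (γ j y) := by
  induction x using TensorProduct.induction_on with
  | zero => simp
  | add x x' hx hx' =>
    simp only [map_add, LinearMap.add_apply, ContinuousMap.add_apply, hx, hx',
      Finset.sum_add_distrib]
  | tmul s f =>
    induction z using TensorProduct.induction_on with
    | zero => simp
    | add z z' hz hz' =>
      simp only [map_add, ContinuousMap.add_apply, hz, hz', Finset.sum_add_distrib]
    | tmul t g =>
      rw [tensorForm_tmul, selfSimilarForm_apply]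
      refine Finset.sum_congr rfl fun j _ => ?_
      change _ = P.form (f (cographMk γ j y) • s) (g (cographMk γ j y) • t) (γ j y)
      rw [map_smul, map_smulₛₗ]
      change _ * (P.form s t (γ j y) * g (cographMk γ j y)) =
        g (cographMk γ j y) * (star (f (cographMk γ j y)) * P.form s t (γ j y))
      ring

/-- The inner tensor product `P ⊗_A X_γ` before completion: the algebraic tensor product with the
form `(s ⊗ f | t ⊗ g)_A = (f | (s|t)_A · g)_A` and the right action on the factor `X_γ`. -/
def innerTensor (P : PreHilbertModule K) (γ : ι → C(K, K)) : PreHilbertModule K where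
  carrier := P.carrier ⊗[ℂ] C(cograph γ, ℂ)
  act := (Module.End.lTensorAlgHom ℂ C(cograph γ, ℂ) P.carrier).comp (rightAct γ)
  form := tensorForm P γ
  star_form x z := by
    ext y
    rw [ContinuousMap.star_apply, tensorForm_apply, tensorForm_apply, star_sum]
    refine Finset.sum_congr rfl fun j _ => ?_
    rw [← P.star_form, ContinuousMap.star_apply, star_star]
  form_nonneg x y := by
    rw [tensorForm_apply]
    exact Finset.sum_nonneg fun j _ => P.form_nonneg _ _
  form_act a x z := by
    induction z using TensorProduct.induction_on with
    | zero => simp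
    | add z z' hz hz' => rw [map_add, map_add, hz, hz', map_add, add_mul]
    | tmul t g =>
      induction x using TensorProduct.induction_on with
      | zero => simp
      | add x x' hx hx' =>
        rw [map_add, LinearMap.add_apply, LinearMap.add_apply, hx, hx', add_mul]
      | tmul s f =>
        change tensorForm P γ (s ⊗ₜ f) (t ⊗ₜ rightAct γ a g) = _
        rw [tensorForm_tmul, tensorForm_tmul]
        refine Eq.trans (congrArg (selfSimilarForm γ f) ?_)
          ((selfSimilarModule γ).form_act a f (leftAct γ (P.form s t) g))
        ext p
        exact mul_left_comm _ _ _

/-- The algebraic tensor power of `X_γ` underlying `X_γ^{⊗n}`: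
`A` for `n = 0`, `X_γ` for `n = 1`, and then inductively `X_γ^{⊗(n+1)} = X_γ^{⊗n} ⊗_A X_γ`. -/
def preTensorPower (γ : ι → C(K, K)) : ℕ → PreHilbertModule K
  | 0 => coefficientModule K
  | 1 => selfSimilarModule γ
  | n + 2 => innerTensor (preTensorPower γ (n + 1)) γ

/-- The `n`-fold inner tensor product `X_γ^{⊗n}`, a Hilbert `C(K)`-module. -/
def selfSimilarPower (γ : ι → C(K, K)) (n : ℕ) : Type u := (preTensorPower γ n).Completion

instance (γ : ι → C(K, K)) (n : ℕ) : NormedAddCommGroup (selfSimilarPower γ n) :=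
  inferInstanceAs (NormedAddCommGroup (preTensorPower γ n).Completion)

instance (γ : ι → C(K, K)) (n : ℕ) : NormedSpace ℂ (selfSimilarPower γ n) :=
  inferInstanceAs (NormedSpace ℂ (preTensorPower γ n).Completion)

instance (γ : ι → C(K, K)) (n : ℕ) : CompleteSpace (selfSimilarPower γ n) :=
  inferInstanceAs (CompleteSpace (preTensorPower γ n).Completion)

instance (γ : ι → C(K, K)) (n : ℕ) : Module C(K, ℂ) (selfSimilarPower γ n) :=
  inferInstanceAs (Module C(K, ℂ) (preTensorPower γ n).Completion)

instance (γ : ι → C(K, K)) (n : ℕ) : CStarModule C(K, ℂ) (selfSimilarPower γ n) :=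
  inferInstanceAs (CStarModule C(K, ℂ) (preTensorPower γ n).Completion)

end Correspondence

end

/-! Evaluating along the words `w` of length `n` turns `X_γ^{⊗n}` into the module of tuples `(x w)`
in `C(K)` with `x w c = x w' c` whenever `γ_w c = γ_w' c`, with inner product `∑ w, star (x w) * y
w`. The identification respects the forms before completion, and it is onto after completion by
Stone–Weierstrass on the cograph of `γ^n` (`cographFunctions_subset_closure`, `exists_completion`).
On such tuples a matrix in `D^{γ^n}` acts by multiplication: the row condition keeps the image in
the module, and the column condition does the same for the adjoint. The operator `θ_{x,y}` is the
action of the matrix `x w * star (y v)`, so the range of this representation contains `K₀`.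
Conversely, every matrix of `D^{γ^n}` acts with finite rank (`matrixRep_mem_finiteRankOperators`).
The compatibility conditions only bite over the finite set `C_{γ^n}`; a finite sum of rank one
matrices matches the given matrix there, and a remainder that vanishes there splits entrywise into
rank one matrices. Testing against suitable tuples bounds each entry by a multiple of the operator
norm (`norm_entry_le`). Hence the representation is injective with closed range, and `K₀`, `K` and
this range coincide. -/

set_option linter.unusedSectionVars false

/-! ### Tuples of functions that factor through the cograph of a family of maps -/

section CographFunctions

variable {K : Type*} [TopologicalSpace K] [CompactSpace K] {W : Type*}

/-- The tuples `x` of the form `x w y = f (g w y, y)` with `f` a function on the cograph of the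
family `g`. -/
def cographFunctions (g : W → K → K) : Submodule ℂ (W → C(K, ℂ)) where
  carrier := {x | ∀ c w w', g w c = g w' c → x w c = x w' c}
  add_mem' hx hy c w w' h := by simp [hx c w w' h, hy c w w' h]
  zero_mem' c w w' h := rfl
  smul_mem' r x hx c w w' h := by simp [hx c w w' h]

theorem mem_cographFunctions {g : W → K → K} {x : W → C(K, ℂ)} :
    x ∈ cographFunctions g ↔ ∀ c w w', g w c = g w' c → x w c = x w' c := Iff.rfl

theorem isClosed_cographFunctions (g : W → K → K) :
    IsClosed (cographFunctions g : Set (W → C(K, ℂ))) := by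
  have : (cographFunctions g : Set (W → C(K, ℂ))) =
      ⋂ (c) (w) (w') (_ : g w c = g w' c), {x | x w c = x w' c} := by
    ext x; simp [mem_cographFunctions]
  rw [this]
  refine isClosed_iInter fun c => isClosed_iInter fun w => isClosed_iInter fun w' =>
    isClosed_iInter fun _ => isClosed_eq ?_ ?_
  · exact (ContinuousEvalConst.continuous_eval_const c).comp (continuous_apply w)
  · exact (ContinuousEvalConst.continuous_eval_const c).comp (continuous_apply w')

/-- Distinct indices can only meet over a branch value, so the gluing condition is vacuous
elsewhere. This is what admits tuples supported in a single coordinate. -/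
theorem mem_cographFunctions_of_eq_zero {g : W → K → K} {x : W → C(K, ℂ)}
    (hx : ∀ c ∈ branchValueSet g, ∀ w, x w c = 0) : x ∈ cographFunctions g := by
  intro c w w' hw
  obtain rfl | hne := eq_or_ne w w'
  · rfl
  · rw [hx c ⟨w, w', hne, hw⟩, hx c ⟨w, w', hne, hw⟩]

/-- A finite set is closed and discrete, so Tietze extends each coordinate separately with values in
`[0, 1]`. Gluing has to be checked only on `S`, which contains all branch values. -/
theorem exists_cographFunction_eqOn [T2Space K] {g : W → K → K} {S : Set K} (hS : S.Finite)
    (hgS : branchValueSet g ⊆ S) (q : K → W → ℝ) (hq : ∀ c w, q c w ∈ Set.Icc (0 : ℝ) 1)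
    (hqg : ∀ c ∈ S, ∀ w w', g w c = g w' c → q c w = q c w') :
    ∃ x ∈ cographFunctions g, (∀ c ∈ S, ∀ w, x w c = q c w) ∧ ∀ w c, ‖x w c‖ ≤ 1 := by
  have : Finite S := hS
  have key : ∀ w, ∃ f : C(K, ℝ), (∀ c, f c ∈ Set.Icc (0 : ℝ) 1) ∧ ∀ c ∈ S, f c = q c w := by
    intro w
    obtain ⟨f, hf, hfS⟩ := ContinuousMap.exists_restrict_eq_forall_mem_of_closed
      (s := S) ⟨fun c => q c w, continuous_of_discreteTopology⟩ (t := Set.Icc (0 : ℝ) 1)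
      (fun c => hq c w) ⟨0, by simp⟩ hS.isClosed
    exact ⟨f, hf, fun c hc => congrArg (fun k : C(S, ℝ) => k ⟨c, hc⟩) hfS⟩
  choose f hf hfS using key
  refine ⟨fun w => ⟨fun c => (f w c : ℂ), by fun_prop⟩, ?_, fun c hc w => ?_, fun w c => ?_⟩
  · intro c w w' hw
    change (f w c : ℂ) = f w' c
    obtain rfl | hne := eq_or_ne w w'
    · rfl
    · have hc : c ∈ S := hgS ⟨w, w', hne, hw⟩
      rw [hfS w c hc, hfS w' c hc, hqg c hc w w' hw]
  · change (f w c : ℂ) = _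
    rw [hfS w c hc]
  · change ‖(f w c : ℂ)‖ ≤ 1
    rw [Complex.norm_real, Real.norm_of_nonneg (hf w c).1]
    exact (hf w c).2

/-- Take `q = √‖d‖` and `p = d / √‖d‖`. Splitting the modulus evenly makes both factors vanish where
`d` does. -/
theorem exists_mul_star_eq (d : C(K, ℂ)) :
    ∃ p q : C(K, ℂ), d = p * star q ∧ ∀ c, d c = 0 → p c = 0 ∧ q c = 0 := by
  let p : K → ℂ := fun c => d c / (√‖d c‖ : ℝ)
  have hnorm : ∀ c, ‖p c‖ = √‖d c‖ := by
    intro c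
    simp only [p, norm_div, Complex.norm_real, Real.norm_of_nonneg (Real.sqrt_nonneg _)]
    exact Real.div_sqrt
  have hp : Continuous p := by
    rw [continuous_iff_continuousAt]
    intro c
    by_cases hc : d c = 0
    -- At a zero of `d` the quotient is `0 / 0 = 0`, and continuity follows from `‖p‖ = √‖d‖`.
    · have hpc : p c = 0 := by simp [p, hc]
      rw [ContinuousAt, hpc, tendsto_zero_iff_norm_tendsto_zero]
      simp_rw [hnorm]
      have : Continuous fun c => √‖d c‖ := by fun_prop
      simpa [hc] using this.tendsto c
    · refine ContinuousAt.div (by fun_prop) (by fun_prop) ?_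
      rw [Complex.ofReal_ne_zero, Real.sqrt_ne_zero']
      exact norm_pos_iff.2 hc
  refine ⟨⟨p, hp⟩, ⟨fun c => (√‖d c‖ : ℝ), by fun_prop⟩, ?_, fun c hc => ?_⟩
  · ext c
    by_cases hc : d c = 0
    · simp [p, hc]
    · have : ((√‖d c‖ : ℝ) : ℂ) ≠ 0 := by
        rw [Complex.ofReal_ne_zero, Real.sqrt_ne_zero']
        exact norm_pos_iff.2 hc
      simp [p, Complex.conj_ofReal, this]
  · simp [p, hc]

/-- Pointwise, one term of a sum of squares is at most the sum. With the next bound, this makes the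
Hilbert module norm equivalent to the sup norm of the coordinates. -/
theorem sq_norm_le_norm_sum_star_mul_self [Fintype W] (u : W → C(K, ℂ)) (w : W) :
    ‖u w‖ ^ 2 ≤ ‖∑ v, star (u v) * u v‖ := by
  rw [← Real.le_sqrt (norm_nonneg _) (norm_nonneg _)]
  refine (ContinuousMap.norm_le _ (Real.sqrt_nonneg _)).2 fun c => ?_
  rw [Real.le_sqrt (norm_nonneg _) (norm_nonneg _)]
  refine le_trans ?_ (ContinuousMap.norm_coe_le_norm _ c)
  have : (∑ v, star (u v) * u v) c = ((∑ v, ‖u v c‖ ^ 2 : ℝ) : ℂ) := by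
    simp [Complex.conj_mul']
  rw [this, Complex.norm_real, Real.norm_of_nonneg (Finset.sum_nonneg fun _ _ => sq_nonneg _)]
  exact Finset.single_le_sum (f := fun v => ‖u v c‖ ^ 2) (fun _ _ => sq_nonneg _)
    (Finset.mem_univ w)

theorem norm_sum_star_mul_self_le [Fintype W] (u : W → C(K, ℂ)) :
    ‖∑ v, star (u v) * u v‖ ≤ (∑ v, ‖u v‖) ^ 2 :=
  calc _ ≤ ∑ v, ‖star (u v) * u v‖ := norm_sum_le _ _
    _ = ∑ v, ‖u v‖ ^ 2 := Finset.sum_congr rfl fun v _ => by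
        rw [CStarRing.norm_star_mul_self, sq]
    _ ≤ _ := Finset.sum_sq_le_sq_sum_of_nonneg fun _ _ => norm_nonneg _

end CographFunctions

/-! ### The algebra `D^γ` for a family with a common left inverse -/

section DegenerateAlgebraOfLeftInverse

variable {K : Type*} [TopologicalSpace K] [CompactSpace K] {W : Type*} [Fintype W]
  {g : W → K → K} {h : K → K}

/-- The point `b` can only be `g j c`, and then `h b = c` is automatic; for `j = j'` nothing is
asked. -/
theorem mem_degenerateAlgebra_iff (hg : ∀ w y, h (g w y) = y)
    {a : CStarMatrix W W C(K, ℂ)} :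
    a ∈ degenerateAlgebra g h ↔
      ∀ c j j', g j c = g j' c → ∀ i, a j i c = a j' i c ∧ a i j c = a i j' c := by
  constructor
  · intro ha c j j' hj i
    obtain rfl | hne := eq_or_ne j j'
    · simp
    · exact ha c ⟨j, j', hne, hj⟩ (g j c) ⟨c, j, j', hne, rfl, hj⟩ (hg j c) j j' rfl hj i
  · intro ha c _ b _ _ j j' hj hj' i
    exact ha c j j' (hj.symm.trans hj') i

theorem continuous_entry (i j : W) :
    Continuous fun a : CStarMatrix W W C(K, ℂ) => a i j :=
  (continuous_apply j).comp (continuous_apply i)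

theorem sum_entry {α : Type*} (s : Finset α) (a : α → degenerateAlgebra g h) (i j : W) :
    (∑ k ∈ s, a k).1 i j = ∑ k ∈ s, (a k).1 i j :=
  map_sum ({ toFun := fun b => b.1 i j, map_zero' := rfl, map_add' := fun _ _ => rfl } :
    degenerateAlgebra g h →+ C(K, ℂ)) a s

theorem isClosed_degenerateAlgebra (g : W → K → K) (h : K → K) :
    IsClosed (degenerateAlgebra g h : Set (CStarMatrix W W C(K, ℂ))) := by
  have hcont (i j : W) (c : K) : Continuous fun a : CStarMatrix W W C(K, ℂ) => a i j c :=
    (ContinuousEvalConst.continuous_eval_const c).comp (continuous_entry i j)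
  have : (degenerateAlgebra g h : Set (CStarMatrix W W C(K, ℂ))) =
      ⋂ (c) (_ : c ∈ branchValueSet g) (b) (_ : b ∈ branchSet g) (_ : h b = c) (j) (j')
        (_ : b = g j c) (_ : b = g j' c) (i),
        {a | a j i c = a j' i c} ∩ {a | a i j c = a i j' c} := by
    ext a
    simp only [Set.mem_iInter]
    rfl
  rw [this]
  refine isClosed_iInter fun c => isClosed_iInter fun _ => isClosed_iInter fun b =>
    isClosed_iInter fun _ => isClosed_iInter fun _ => isClosed_iInter fun j =>
    isClosed_iInter fun j' => isClosed_iInter fun _ => isClosed_iInter fun _ =>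
    isClosed_iInter fun i => ?_
  exact (isClosed_eq (hcont j i c) (hcont j' i c)).inter
    (isClosed_eq (hcont i j c) (hcont i j' c))

end DegenerateAlgebraOfLeftInverse

/-! ### Finite rank operators -/

section FiniteRank

variable {A E : Type*} [CommCStarAlgebra A] [PartialOrder A] [StarOrderedRing A]
  [NormedAddCommGroup E] [NormedSpace ℂ E] [Module A E] [CStarModule A E]

theorem rankOne_mem_finiteRankOperators (x y : E) :
    rankOne A x y ∈ finiteRankOperators A E :=
  ⟨1, fun _ => x, fun _ => y, by simp⟩

theorem zero_mem_finiteRankOperators : (0 : AdjointableOp A E) ∈ finiteRankOperators A E :=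
  ⟨0, Fin.elim0, Fin.elim0, by simp⟩

theorem add_mem_finiteRankOperators {S T : AdjointableOp A E}
    (hS : S ∈ finiteRankOperators A E) (hT : T ∈ finiteRankOperators A E) :
    S + T ∈ finiteRankOperators A E := by
  obtain ⟨m, x, y, rfl⟩ := hS
  obtain ⟨m', x', y', rfl⟩ := hT
  exact ⟨m + m', Fin.append x x', Fin.append y y', by simp [Fin.sum_univ_add]⟩

theorem sum_mem_finiteRankOperators {α : Type*} (s : Finset α) {T : α → AdjointableOp A E}
    (hT : ∀ i ∈ s, T i ∈ finiteRankOperators A E) :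
    ∑ i ∈ s, T i ∈ finiteRankOperators A E :=
  Finset.sum_induction _ _ (fun _ _ => add_mem_finiteRankOperators)
    zero_mem_finiteRankOperators hT

theorem finiteRankOperators_subset_compactOperators :
    finiteRankOperators A E ⊆ (compactOperators A E : Set (AdjointableOp A E)) := by
  rintro T ⟨m, x, y, rfl⟩
  exact sum_mem fun i _ => NonUnitalStarSubalgebra.le_topologicalClosure _
    (NonUnitalStarAlgebra.subset_adjoin ℂ _ ⟨x i, y i, rfl⟩)

end FiniteRank

/-! ### Hilbert modules of functions on a cograph -/

section Coordinatization

variable {K : Type*} [TopologicalSpace K] [CompactSpace K] {W : Type*} [Fintype W]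
  {E : Type*} [NormedAddCommGroup E] [NormedSpace ℂ E] [Module C(K, ℂ) E]
  [CStarModule C(K, ℂ) E]

/-- The linear map `ev` identifies the Hilbert module `E` with the tuples of functions that factor
through the cograph of `g`, with the inner product `∑ w, conj (x w) * y w`. -/
structure IsCoordinatization (g : W → K → K) (ev : E →ₗ[ℂ] (W → C(K, ℂ))) : Prop where
  inner_eq : ∀ x y, inner C(K, ℂ) x y = ∑ w, star (ev x w) * ev y w
  range_eq : LinearMap.range ev = cographFunctions g

namespace IsCoordinatization

variable {g : W → K → K} {h : K → K} {ev : E →ₗ[ℂ] (W → C(K, ℂ))} (H : IsCoordinatization g ev)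
include H

theorem injective : Function.Injective ev := fun x y hxy =>
  CStarModule.eq_of_inner_left (A := C(K, ℂ)) fun z => by rw [H.inner_eq, H.inner_eq, hxy]

theorem apply_mem (x : E) : ev x ∈ cographFunctions g :=
  H.range_eq ▸ LinearMap.mem_range_self ev x

theorem exists_eq {x : W → C(K, ℂ)} (hx : x ∈ cographFunctions g) : ∃ z, ev z = x := by
  rwa [← H.range_eq] at hx

/-- Linearity over `C(K)` comes for free: the tuple `a * ev x` is the image of some vector, which
has the same inner products as `a • x`. -/
theorem ev_smul (a : C(K, ℂ)) (x : E) (w : W) : ev (a • x) w = a * ev x w := by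
  have hx := H.apply_mem x
  obtain ⟨u, hu⟩ := H.exists_eq (x := fun w => a * ev x w) fun c w w' hw => by
    simp [hx c w w' hw]
  have : a • x = u := CStarModule.eq_of_inner_left (A := C(K, ℂ)) fun z => by
    rw [CStarModule.inner_op_smul_right, H.inner_eq, H.inner_eq, hu, Finset.mul_sum]
    exact Finset.sum_congr rfl fun w _ => by ring
  rw [this, hu]

theorem norm_ev_le (x : E) (w : W) : ‖ev x w‖ ≤ ‖x‖ := by
  rw [← pow_le_pow_iff_left₀ (norm_nonneg _) (norm_nonneg _) two_ne_zero,
    CStarModule.norm_sq_eq C(K, ℂ) (x := x), H.inner_eq]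
  exact sq_norm_le_norm_sum_star_mul_self (ev x) w

theorem norm_le_sum (x : E) : ‖x‖ ≤ ∑ w, ‖ev x w‖ := by
  rw [← pow_le_pow_iff_left₀ (norm_nonneg _) (Finset.sum_nonneg fun _ _ => norm_nonneg _)
    two_ne_zero, CStarModule.norm_sq_eq C(K, ℂ), H.inner_eq]
  exact norm_sum_star_mul_self_le (ev x)

/-- The linear equivalence of `E` with the tuples that factor through the cograph. -/
noncomputable def equiv : E ≃ₗ[ℂ] cographFunctions g :=
  (LinearEquiv.ofInjective ev H.injective).trans (LinearEquiv.ofEq _ _ H.range_eq)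

theorem ev_equiv_symm (x : cographFunctions g) : ev (H.equiv.symm x) = x :=
  congrArg Subtype.val (H.equiv.apply_symm_apply x)

/-- Only the equality of rows enters here; the equality of columns is the same fact for `star a`. -/
theorem mulVec_mem (hg : ∀ w y, h (g w y) = y) (a : degenerateAlgebra g h) (z : E) :
    (fun w => ∑ v, a.1 w v * ev z v) ∈ cographFunctions g := by
  intro c w w' hw
  simp only [ContinuousMap.coe_sum, Finset.sum_apply, ContinuousMap.coe_mul, Pi.mul_apply]
  exact Finset.sum_congr rfl fun v _ => by
    rw [((mem_degenerateAlgebra_iff hg).1 a.2 c w w' hw v).1]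

/-- The action of a matrix in `D^γ` on `E`, as a bounded operator. -/
noncomputable def matrixCLM (hg : ∀ w y, h (g w y) = y) (a : degenerateAlgebra g h) :
    E →L[ℂ] E :=
  LinearMap.mkContinuous
    { toFun := fun z => H.equiv.symm ⟨fun w => ∑ v, a.1 w v * ev z v, H.mulVec_mem hg a z⟩
      map_add' := fun x y => by
        refine H.injective ?_
        simp only [map_add, H.ev_equiv_symm]
        ext w : 1
        simp [mul_add, Finset.sum_add_distrib]
      map_smul' := fun r x => by
        refine H.injective ?_
        simp only [map_smul, H.ev_equiv_symm, RingHom.id_apply]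
        ext w : 1
        simp [Finset.smul_sum] }
    (∑ w, ∑ v, ‖a.1 w v‖) fun z => by
      refine (H.norm_le_sum _).trans ?_
      rw [Finset.sum_mul]
      refine Finset.sum_le_sum fun w _ => ?_
      simp only [LinearMap.coe_mk, AddHom.coe_mk, H.ev_equiv_symm]
      refine (norm_sum_le _ _).trans ?_
      rw [Finset.sum_mul]
      refine Finset.sum_le_sum fun v _ => (norm_mul_le _ _).trans ?_
      gcongr
      exact H.norm_ev_le z v

theorem ev_matrixCLM (hg : ∀ w y, h (g w y) = y) (a : degenerateAlgebra g h) (z : E) (w : W) :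
    ev (H.matrixCLM hg a z) w = ∑ v, a.1 w v * ev z v :=
  congrFun (H.ev_equiv_symm ⟨fun w => ∑ v, a.1 w v * ev z v, H.mulVec_mem hg a z⟩) w

theorem inner_matrixCLM (hg : ∀ w y, h (g w y) = y) (a : degenerateAlgebra g h) (x y : E) :
    inner C(K, ℂ) (H.matrixCLM hg a x) y = inner C(K, ℂ) x (H.matrixCLM hg (star a) y) := by
  simp only [H.inner_eq, H.ev_matrixCLM, star_sum, star_mul, Finset.sum_mul, Finset.mul_sum]
  rw [Finset.sum_comm]
  refine Finset.sum_congr rfl fun v _ => Finset.sum_congr rfl fun w _ => ?_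
  change _ = star (ev x v) * (star (a.1 w v) * ev y w)
  ring

theorem adjointableOp_ext {S T : AdjointableOp C(K, ℂ) E}
    (hST : ∀ z w, ev (S.1 z) w = ev (T.1 z) w) : S = T :=
  Subtype.ext <| ContinuousLinearMap.ext fun z => H.injective <| funext fun w => hST z w

/-- The representation of `D^γ` on `E` by adjointable operators. -/
noncomputable def matrixRep (hg : ∀ w y, h (g w y) = y) :
    degenerateAlgebra g h →⋆ₙₐ[ℂ] AdjointableOp C(K, ℂ) E where
  toFun a := ⟨H.matrixCLM hg a, H.matrixCLM hg (star a), H.inner_matrixCLM hg a⟩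
  map_smul' r a := H.adjointableOp_ext fun z w => by
    change ev (H.matrixCLM hg (r • a) z) w = ev (r • H.matrixCLM hg a z) w
    rw [map_smul, Pi.smul_apply, H.ev_matrixCLM, H.ev_matrixCLM, Finset.smul_sum]
    exact Finset.sum_congr rfl fun v _ => smul_mul_assoc r (a.1 w v) (ev z v)
  map_zero' := H.adjointableOp_ext fun z w => by
    change ev (H.matrixCLM hg 0 z) w = ev 0 w
    rw [map_zero, H.ev_matrixCLM]
    exact Finset.sum_eq_zero fun v _ => zero_mul _
  map_add' a b := H.adjointableOp_ext fun z w => by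
    change ev (H.matrixCLM hg (a + b) z) w = ev (H.matrixCLM hg a z + H.matrixCLM hg b z) w
    rw [map_add, Pi.add_apply, H.ev_matrixCLM, H.ev_matrixCLM, H.ev_matrixCLM,
      ← Finset.sum_add_distrib]
    exact Finset.sum_congr rfl fun v _ => add_mul _ _ _
  map_mul' a b := H.adjointableOp_ext fun z w => by
    change ev (H.matrixCLM hg (a * b) z) w = ev (H.matrixCLM hg a (H.matrixCLM hg b z)) w
    simp only [H.ev_matrixCLM, Finset.mul_sum]
    rw [Finset.sum_comm]
    refine Finset.sum_congr rfl fun v _ => ?_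
    change (a.1 * b.1) w v * _ = _
    rw [CStarMatrix.mul_apply, Finset.sum_mul]
    exact Finset.sum_congr rfl fun u _ => mul_assoc _ _ _
  -- The involution of `L(E)` is a chosen adjoint, so it is matched with the action of `star a` by
  -- uniqueness of adjoints.
  map_star' a := adjointableOperators_ext (A := C(K, ℂ)) (E := E)
    (T := ⟨H.matrixCLM hg a, H.matrixCLM hg (star a), H.inner_matrixCLM hg a⟩)
    (fun x y => H.inner_matrixCLM hg a x y) (fun x y => inner_star_right _ x y)

theorem ev_matrixRep (hg : ∀ w y, h (g w y) = y) (a : degenerateAlgebra g h) (z : E) (w : W) :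
    ev ((H.matrixRep hg a).1 z) w = ∑ v, a.1 w v * ev z v :=
  H.ev_matrixCLM hg a z w

/-- The matrix of a rank one operator. -/
noncomputable def rankOneMatrix (hg : ∀ w y, h (g w y) = y) (x y : E) : degenerateAlgebra g h :=
  ⟨CStarMatrix.ofMatrix (Matrix.of fun w v => ev x w * star (ev y v)),
    (mem_degenerateAlgebra_iff hg).2 fun c j j' hj i => by
      have hx := H.apply_mem x c j j' hj
      have hy := H.apply_mem y c j j' hj
      change ev x j c * star (ev y i c) = ev x j' c * star (ev y i c) ∧
        ev x i c * star (ev y j c) = ev x i c * star (ev y j' c)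
      rw [hx, hy]
      exact ⟨rfl, rfl⟩⟩

theorem rankOneMatrix_apply (hg : ∀ w y, h (g w y) = y) (x y : E) (w v : W) :
    (H.rankOneMatrix hg x y).1 w v = ev x w * star (ev y v) := rfl

theorem matrixRep_rankOneMatrix (hg : ∀ w y, h (g w y) = y) (x y : E) :
    H.matrixRep hg (H.rankOneMatrix hg x y) = rankOne C(K, ℂ) x y :=
  H.adjointableOp_ext fun z w => by
    rw [H.ev_matrixRep]
    change _ = ev (inner C(K, ℂ) y z • x) w
    rw [H.ev_smul, H.inner_eq, Finset.sum_mul]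
    refine Finset.sum_congr rfl fun v _ => ?_
    rw [H.rankOneMatrix_apply]
    ring

theorem finiteRankOperators_subset_range (hg : ∀ w y, h (g w y) = y) :
    finiteRankOperators C(K, ℂ) E ⊆ Set.range (H.matrixRep hg) := by
  rintro T ⟨m, x, y, rfl⟩
  exact ⟨∑ i, H.rankOneMatrix hg (x i) (y i), by
    rw [map_sum]; simp only [H.matrixRep_rankOneMatrix]⟩

-- The matrix is first corrected by rank one matrices to one vanishing over all branch values; each
-- entry of the remainder is then a rank one matrix by itself.
open Classical in
theorem matrixRep_mem_finiteRankOperators [T2Space K] (hg : ∀ w y, h (g w y) = y)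
    (hC : (branchValueSet g).Finite) (a : degenerateAlgebra g h) :
    H.matrixRep hg a ∈ finiteRankOperators C(K, ℂ) E := by
  have ha := (mem_degenerateAlgebra_iff hg).1 a.2
  have hcol (v : W) : ∃ x, ev x = fun w => a.1 w v :=
    H.exists_eq fun c w w' hw => (ha c w w' hw v).1
  choose x hx using hcol
  -- Over a branch value `y v` is the normalized indicator of the indices that meet `v`. Pairing a
  -- row with these functions thus averages it over each such class.
  have hind (v : W) : ∃ y, ∀ c ∈ branchValueSet g, ∀ w,
      ev y w c = ((if g w c = g v c then
        (1 : ℝ) / (Finset.univ.filter fun u => g u c = g v c).card else 0 : ℝ) : ℂ) := by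
    obtain ⟨y, hy, hyC, -⟩ := exists_cographFunction_eqOn hC le_rfl
      (fun c w => if g w c = g v c then
        (1 : ℝ) / (Finset.univ.filter fun u => g u c = g v c).card else 0)
      (fun c w => by
        split_ifs
        · exact ⟨by positivity, by
            rw [one_div]; exact Nat.cast_inv_le_one _⟩
        · simp)
      (fun c _ w w' hw => by simp only [hw])
    obtain ⟨z, rfl⟩ := H.exists_eq hy
    exact ⟨z, hyC⟩
  choose y hy using hind
  let d : degenerateAlgebra g h := a - ∑ v, H.rankOneMatrix hg (x v) (y v)
  have hd_apply (w v : W) : d.1 w v = a.1 w v - ∑ u, a.1 w u * star (ev (y u) v) := by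
    change _ - (∑ u, H.rankOneMatrix hg (x u) (y u)).1 w v = _
    rw [sum_entry]
    simp only [H.rankOneMatrix_apply, hx]
  have hd (w v : W) : ∀ c ∈ branchValueSet g, d.1 w v c = 0 := by
    intro c hc
    rw [hd_apply]
    simp only [ContinuousMap.sub_apply, ContinuousMap.coe_sum, Finset.sum_apply,
      ContinuousMap.mul_apply, ContinuousMap.star_apply, hy _ c hc]
    -- By the column condition the row is constant on the class of `v`, so averaging returns `a w v
    -- c`.
    have hterm (u : W) : a.1 w u c * star (((if g v c = g u c then
        (1 : ℝ) / (Finset.univ.filter fun t => g t c = g u c).card else 0 : ℝ) : ℂ)) =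
        if g u c = g v c then
          a.1 w v c * (1 / (Finset.univ.filter fun t => g t c = g v c).card) else 0 := by
      by_cases huv : g u c = g v c
      · rw [if_pos huv.symm, if_pos huv, (ha c u v huv w).2, huv]
        simp
      · rw [if_neg (Ne.symm huv), if_neg huv]
        simp
    rw [Finset.sum_congr rfl fun u _ => hterm u, ← Finset.sum_filter, Finset.sum_const,
      nsmul_eq_mul]
    have hcard : ((Finset.univ.filter fun t => g t c = g v c).card : ℂ) ≠ 0 := by
      rw [Nat.cast_ne_zero]
      exact (Finset.card_pos.2 ⟨v, by simp⟩).ne'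
    field_simp
    simp
  -- The matrix with the single entry `d w v` has rank one: both factors of `d w v` vanish over the
  -- branch values, so each may be placed in one coordinate and extended by zero.
  have hfac (w v : W) : ∃ p q : E, ∀ s t, ev p s * star (ev q t) = if s = w ∧ t = v then d.1 w v else 0 := by
    obtain ⟨p, q, hpq, hz⟩ := exists_mul_star_eq (d.1 w v)
    obtain ⟨p', hp'⟩ := H.exists_eq (x := Pi.single w p) <| mem_cographFunctions_of_eq_zero
      fun c hc s => by
        obtain rfl | hs := eq_or_ne s w
        · rw [Pi.single_eq_same, (hz c (hd _ v c hc)).1]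
        · rw [Pi.single_eq_of_ne hs]; rfl
    obtain ⟨q', hq'⟩ := H.exists_eq (x := Pi.single v q) <| mem_cographFunctions_of_eq_zero
      fun c hc s => by
        obtain rfl | hs := eq_or_ne s v
        · rw [Pi.single_eq_same, (hz c (hd w _ c hc)).2]
        · rw [Pi.single_eq_of_ne hs]; rfl
    refine ⟨p', q', fun s t => ?_⟩
    rw [hp', hq', hpq]
    by_cases hs : s = w <;> by_cases ht : t = v <;> simp [hs, ht]
  choose p q hpq using hfac
  have hdsum : d = ∑ w, ∑ v, H.rankOneMatrix hg (p w v) (q w v) := by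
    refine Subtype.ext (CStarMatrix.ext fun s t => ?_)
    simp only [sum_entry, H.rankOneMatrix_apply, hpq]
    rw [Finset.sum_eq_single s, Finset.sum_eq_single t]
    · simp
    · intro v _ hv
      simp [hv.symm]
    · simp
    · intro w _ hw
      simp [hw.symm]
    · simp
  have hsplit : H.matrixRep hg a = ∑ w, ∑ v, rankOne C(K, ℂ) (p w v) (q w v) +
      ∑ v, rankOne C(K, ℂ) (x v) (y v) := by
    simp only [← H.matrixRep_rankOneMatrix hg, ← map_sum, ← map_add, ← hdsum]
    simp [d]
  rw [hsplit]
  exact add_mem_finiteRankOperators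
    (sum_mem_finiteRankOperators _ fun w _ => sum_mem_finiteRankOperators _ fun v _ =>
      rankOne_mem_finiteRankOperators _ _)
    (sum_mem_finiteRankOperators _ fun v _ => rankOne_mem_finiteRankOperators _ _)

-- Fix `c` and test on a tuple `z` bounded by `1` whose value at `c` is the indicator of the class
-- of `v`. The `w`-coordinate of the image at `c` is `a w v c` times the size of that class, which
-- is at least `1`, while `‖z‖` is at most the number of indices.
open Classical in
theorem norm_entry_le [T2Space K] (hg : ∀ w y, h (g w y) = y)
    (hC : (branchValueSet g).Finite) (a : degenerateAlgebra g h) (w v : W) :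
    ‖a.1 w v‖ ≤ Fintype.card W * ‖H.matrixRep hg a‖ := by
  have ha := (mem_degenerateAlgebra_iff hg).1 a.2
  refine (ContinuousMap.norm_le _ (by positivity)).2 fun c => ?_
  -- The point `c` need not be a branch value, hence the insertion.
  obtain ⟨z, hz, hzc, hz1⟩ := exists_cographFunction_eqOn (hC.insert c) (Set.subset_insert _ _)
    (fun s u => if g u s = g v s then 1 else 0) (fun s u => by split_ifs <;> simp)
    (fun s _ u u' hu => by simp only [hu])
  obtain ⟨z, rfl⟩ := H.exists_eq hz
  have hznorm : ‖z‖ ≤ Fintype.card W := by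
    refine (H.norm_le_sum z).trans ?_
    calc _ ≤ ∑ _w : W, (1 : ℝ) := Finset.sum_le_sum fun u _ =>
          (ContinuousMap.norm_le _ zero_le_one).2 (hz1 u)
      _ = _ := by simp
  have hval : ev ((H.matrixRep hg a).1 z) w c =
      ((Finset.univ.filter fun u => g u c = g v c).card : ℂ) * a.1 w v c := by
    rw [H.ev_matrixRep]
    simp only [ContinuousMap.coe_sum, Finset.sum_apply, ContinuousMap.mul_apply,
      hzc c (Set.mem_insert _ _)]
    have hterm (u : W) : a.1 w u c * (((if g u c = g v c then 1 else 0 : ℝ) : ℂ)) =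
        if g u c = g v c then a.1 w v c else 0 := by
      by_cases hu : g u c = g v c
      · simp [hu, (ha c u v hu w).2]
      · simp [hu]
    rw [Finset.sum_congr rfl fun u _ => hterm u, ← Finset.sum_filter, Finset.sum_const,
      nsmul_eq_mul]
  have hcard : (1 : ℝ) ≤ (Finset.univ.filter fun u => g u c = g v c).card := by
    exact_mod_cast Finset.card_pos.2 ⟨v, by simp⟩
  calc ‖a.1 w v c‖ ≤ ‖ev ((H.matrixRep hg a).1 z) w c‖ := by
        rw [hval, norm_mul, Complex.norm_natCast]
        exact le_mul_of_one_le_left (norm_nonneg _) hcard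
    _ ≤ ‖(H.matrixRep hg a).1 z‖ :=
        (ContinuousMap.norm_coe_le_norm _ c).trans (H.norm_ev_le _ w)
    _ ≤ ‖H.matrixRep hg a‖ * ‖z‖ := (H.matrixRep hg a).1.le_opNorm z
    _ ≤ ‖H.matrixRep hg a‖ * Fintype.card W := by gcongr
    _ = _ := mul_comm _ _

theorem matrixRep_injective [T2Space K] (hg : ∀ w y, h (g w y) = y)
    (hC : (branchValueSet g).Finite) : Function.Injective (H.matrixRep hg) := by
  refine (injective_iff_map_eq_zero (H.matrixRep hg)).2 fun a ha => ?_
  refine Subtype.ext (CStarMatrix.ext fun w v => ?_)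
  have := H.norm_entry_le hg hC a w v
  rw [ha, norm_zero, mul_zero, norm_le_zero_iff] at this
  exact this

/-- By `norm_entry_le`, norm convergence of the operators makes the entries Cauchy. The entrywise
limit stays in the closed algebra `D^γ` and acts as the limit operator. -/
theorem isClosed_range_matrixRep [T2Space K] (hg : ∀ w y, h (g w y) = y)
    (hC : (branchValueSet g).Finite) : IsClosed (Set.range (H.matrixRep hg)) := by
  refine isClosed_of_closure_subset fun T hT => ?_
  obtain ⟨t, ht, hlim⟩ := mem_closure_iff_seq_limit.1 hT
  choose a ha using ht
  have hcauchy (w v : W) : CauchySeq fun k => (a k).1 w v := by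
    have ht := Metric.cauchySeq_iff.1 hlim.cauchySeq
    refine Metric.cauchySeq_iff.2 fun ε hε => ?_
    -- The `+ 1` keeps the denominator positive when `W` is empty.
    obtain ⟨M, hM⟩ := ht (ε / (Fintype.card W + 1)) (by positivity)
    refine ⟨M, fun m hm n hn => ?_⟩
    have h1 := hM m hm n hn
    rw [dist_eq_norm, ← ha, ← ha, ← map_sub, lt_div_iff₀ (by positivity)] at h1
    rw [dist_eq_norm]
    refine lt_of_le_of_lt (H.norm_entry_le hg hC (a m - a n) w v) (lt_of_le_of_lt ?_ h1)
    rw [mul_comm]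
    gcongr
    simp
  choose b hb using fun w v => cauchySeq_tendsto_of_complete (hcauchy w v)
  have hbmem : CStarMatrix.ofMatrix (Matrix.of b) ∈ degenerateAlgebra g h := by
    refine (isClosed_degenerateAlgebra g h).mem_of_tendsto (b := Filter.atTop)
      (f := fun k => (a k).1) ?_ (Filter.Eventually.of_forall fun k => (a k).2)
    exact tendsto_pi_nhds.2 fun w => tendsto_pi_nhds.2 fun v => hb w v
  refine ⟨⟨_, hbmem⟩, H.adjointableOp_ext fun z w => ?_⟩
  have hev : Continuous ev :=
    continuous_pi fun w => (LinearMap.mkContinuous ((LinearMap.proj w).comp ev) 1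
      fun x => by simpa using H.norm_ev_le x w).continuous
  have h1 : Filter.Tendsto (fun k => ev ((t k).1 z) w) Filter.atTop (nhds (ev (T.1 z) w)) := by
    have hcont : Continuous fun S : AdjointableOp C(K, ℂ) E => ev (S.1 z) w :=
      (continuous_apply w).comp (hev.comp
        ((ContinuousLinearMap.apply ℂ E z).continuous.comp continuous_subtype_val))
    exact (hcont.tendsto T).comp hlim
  refine tendsto_nhds_unique ?_ h1
  simp only [← ha, H.ev_matrixRep]
  exact tendsto_finsetSum _ fun v _ => (hb w v).mul tendsto_const_nhds

theorem finiteRankOperators_eq_range [T2Space K] (hg : ∀ w y, h (g w y) = y)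
    (hC : (branchValueSet g).Finite) :
    finiteRankOperators C(K, ℂ) E = Set.range (H.matrixRep hg) :=
  (H.finiteRankOperators_subset_range hg).antisymm <| by
    rintro _ ⟨a, rfl⟩
    exact H.matrixRep_mem_finiteRankOperators hg hC a

/-- The range is a closed ⋆-subalgebra containing every `θ_{x,y}`, and it equals `K₀`, which lies in
`K`. -/
theorem compactOperators_eq_range [T2Space K] (hg : ∀ w y, h (g w y) = y)
    (hC : (branchValueSet g).Finite) :
    (compactOperators C(K, ℂ) E : Set (AdjointableOp C(K, ℂ) E)) =
      Set.range (H.matrixRep hg) := by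
  refine Set.Subset.antisymm ?_ ?_
  · refine closure_minimal ?_ (H.isClosed_range_matrixRep hg hC)
    rw [← NonUnitalStarAlgHom.coe_range]
    refine SetLike.coe_subset_coe.2 (NonUnitalStarAlgebra.adjoin_le ?_)
    rintro _ ⟨x, y, rfl⟩
    exact ⟨H.rankOneMatrix hg x y, H.matrixRep_rankOneMatrix hg x y⟩
  · rw [← H.finiteRankOperators_eq_range hg hC]
    exact finiteRankOperators_subset_compactOperators

/-- The ⋆-isomorphism of `K(E)` with `D^γ`. -/
noncomputable def compactOperatorsEquiv [T2Space K] (hg : ∀ w y, h (g w y) = y)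
    (hC : (branchValueSet g).Finite) :
    compactOperators C(K, ℂ) E ≃⋆ₐ[ℂ] degenerateAlgebra g h :=
  (StarAlgEquiv.ofBijective
    (NonUnitalStarAlgHom.codRestrict (H.matrixRep hg) (compactOperators C(K, ℂ) E) fun a => by
      rw [← SetLike.mem_coe, H.compactOperators_eq_range hg hC]
      exact ⟨a, rfl⟩)
    ⟨fun a b hab => H.matrixRep_injective hg hC (congrArg Subtype.val hab), fun T => by
      have hT : T.1 ∈ Set.range (H.matrixRep hg) := by
        rw [← H.compactOperators_eq_range hg hC]
        exact T.2
      obtain ⟨a, ha⟩ := hT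
      exact ⟨a, Subtype.ext ha⟩⟩).symm

end IsCoordinatization

end Coordinatization

/-! ### Density of products of functions of one variable -/

section Density

variable {K : Type*} [MetricSpace K] [CompactSpace K] {W : Type*} [Fintype W]

/-- A compatible tuple is a continuous function on the compact cograph `Z`, where the functions
`a(x) b(y)` span a unital ⋆-algebra that separates points; Stone–Weierstrass applies. -/
theorem cographFunctions_subset_closure {g : W → K → K} (hg : ∀ w, Continuous (g w))
    (M : Submodule ℂ (W → C(K, ℂ)))
    (hM : ∀ a b : C(K, ℂ), ∃ x ∈ M, ∀ w c, x w c = a (g w c) * b c) :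
    (cographFunctions g : Set (W → C(K, ℂ))) ⊆ closure M := by
  intro x hx
  let _ : TopologicalSpace W := ⊥
  have : DiscreteTopology W := ⟨rfl⟩
  let q : W × K → K × K := fun p => (g p.1 p.2, p.2)
  have hq : Continuous q := continuous_prod_of_discrete_left.2 fun w =>
    (hg w).prodMk continuous_id
  let Z := Set.range q
  have : CompactSpace Z := isCompact_iff_compactSpace.1 (isCompact_range hq)
  let q' : C(W × K, Z) := ⟨Set.rangeFactorization q, hq.subtype_mk _⟩
  -- A continuous surjection from a compact space to a Hausdorff space is a quotient map, so a tuple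
  -- constant on fibres descends to a continuous function on `Z`.
  have hq' : Topology.IsQuotientMap q' :=
    q'.continuous.isClosedMap.isQuotientMap q'.continuous Set.rangeFactorization_surjective
  let X : C(W × K, ℂ) := ⟨fun p => x p.1 p.2, continuous_prod_of_discrete_left.2 fun w =>
    (x w).continuous⟩
  have hX : Function.FactorsThrough X q' := fun p p' hpp' => by
    have h1 := congrArg (fun z : Z => z.1.1) hpp'
    have h2 := congrArg (fun z : Z => z.1.2) hpp'
    obtain ⟨w, c⟩ := p
    obtain ⟨w', c'⟩ := p'
    change g w c = g w' c' at h1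
    change c = c' at h2
    subst h2
    exact hx c w w' h1
  let f : C(Z, ℂ) := hq'.lift X hX
  have hf (w : W) (c : K) : f (q' (w, c)) = x w c :=
    congrArg (fun k : C(W × K, ℂ) => k (w, c)) (hq'.lift_comp X hX)
  let slice (w : W) : C(K, Z) := ⟨fun c => q' (w, c), by fun_prop⟩
  -- `R` carries the approximation on `Z` back to tuples, by restriction to the graphs of the `g w`.
  let R : C(Z, ℂ) →ₗ[ℂ] (W → C(K, ℂ)) :=
    { toFun := fun k w => k.comp (slice w)
      map_add' := fun _ _ => rfl
      map_smul' := fun _ _ => rfl }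
  have hR : Continuous R := continuous_pi fun w => ContinuousMap.continuous_precomp (slice w)
  let fstZ : C(Z, K) := ⟨fun z => z.1.1, by fun_prop⟩
  let sndZ : C(Z, K) := ⟨fun z => z.1.2, by fun_prop⟩
  let G : Set C(Z, ℂ) := {k | ∃ a b : C(K, ℂ), k = a.comp fstZ * b.comp sndZ}
  let S : StarSubalgebra ℂ C(Z, ℂ) :=
    { carrier := Submodule.span ℂ G
      add_mem' := fun h1 h2 => add_mem h1 h2
      zero_mem' := zero_mem _
      one_mem' := Submodule.subset_span ⟨1, 1, by ext; simp⟩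
      mul_mem' := fun {k l} hk hl => by
        have := Submodule.mul_mem_mul hk hl
        rw [Submodule.span_mul_span] at this
        refine Submodule.span_mono ?_ this
        rintro _ ⟨_, ⟨a, b, rfl⟩, _, ⟨a', b', rfl⟩, rfl⟩
        exact ⟨a * a', b * b', by ext; simp; ring⟩
      algebraMap_mem' := fun r => Submodule.subset_span
        ⟨algebraMap ℂ _ r, 1, by ext; simp⟩
      star_mem' := fun {k} hk => by
        refine Submodule.span_induction (p := fun k _ => star k ∈ Submodule.span ℂ G)
          ?_ ?_ ?_ ?_ hk
        · rintro _ ⟨a, b, rfl⟩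
          exact Submodule.subset_span ⟨star a, star b, by ext; simp⟩
        · simp
        · intro k l _ _ h1 h2
          rw [star_add]
          exact add_mem h1 h2
        · intro r k _ h1
          rw [star_smul]
          exact Submodule.smul_mem _ _ h1 }
  have hS : S.SeparatesPoints := by
    intro z z' hzz'
    by_cases h1 : z.1.1 = z'.1.1
    · have h2 : z.1.2 ≠ z'.1.2 := fun h2 => hzz' (Subtype.ext (Prod.ext h1 h2))
      let b : C(K, ℂ) := ⟨fun y => (dist y z.1.2 : ℝ), by fun_prop⟩
      refine ⟨_, ⟨(1 : C(K, ℂ)).comp fstZ * b.comp sndZ,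
        Submodule.subset_span ⟨1, b, rfl⟩, rfl⟩, ?_⟩
      intro h0
      have h3 : ((dist z.1.2 z.1.2 : ℝ) : ℂ) = (dist z'.1.2 z.1.2 : ℝ) := by
        simpa [b, sndZ] using h0
      rw [dist_self, Complex.ofReal_inj] at h3
      exact h2 (dist_eq_zero.1 h3.symm).symm
    · let a : C(K, ℂ) := ⟨fun y => (dist y z.1.1 : ℝ), by fun_prop⟩
      refine ⟨_, ⟨a.comp fstZ * (1 : C(K, ℂ)).comp sndZ,
        Submodule.subset_span ⟨a, 1, rfl⟩, rfl⟩, ?_⟩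
      intro h0
      have h3 : ((dist z.1.1 z.1.1 : ℝ) : ℂ) = (dist z'.1.1 z.1.1 : ℝ) := by
        simpa [a, fstZ] using h0
      rw [dist_self, Complex.ofReal_inj] at h3
      exact h1 (dist_eq_zero.1 h3.symm).symm
  have hSM : ∀ k ∈ S, R k ∈ M := by
    have : Submodule.span ℂ G ≤ M.comap R := by
      refine Submodule.span_le.2 ?_
      rintro _ ⟨a, b, rfl⟩
      obtain ⟨m, hm, hmab⟩ := hM a b
      have : R (a.comp fstZ * b.comp sndZ) = m := by
        ext w c
        exact (hmab w c).symm
      change R _ ∈ M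
      rwa [this]
    exact fun k hk => this hk
  have hfS : f ∈ closure (S : Set C(Z, ℂ)) := by
    rw [← StarSubalgebra.topologicalClosure_coe,
      ContinuousMap.starSubalgebra_topologicalClosure_eq_top_of_separatesPoints S hS]
    trivial
  have hRf : R f = x := by
    ext w c
    exact hf w c
  rw [← hRf]
  exact map_mem_closure hR hfS hSM

end Density

/-! ### Completions of modules with coordinates -/

section Completion

variable {K : Type u} [MetricSpace K] [CompactSpace K] {W : Type*} [Fintype W]

/-- The linear map `ev` sends the pre-Hilbert module `P` to tuples of functions that factor through
the cograph of `g`, preserving the inner product, and its range contains the tuples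
`w y ↦ a (g w y) * b y`. -/
structure PreHilbertModule.IsCoordinatization (P : PreHilbertModule K) (g : W → K → K)
    (ev : P.carrier →ₗ[ℂ] (W → C(K, ℂ))) : Prop where
  form_eq : ∀ x y, P.form x y = ∑ w, star (ev x w) * ev y w
  apply_mem : ∀ x, ev x ∈ cographFunctions g
  exists_eq : ∀ a b : C(K, ℂ), ∃ x, ∀ w c, ev x w c = a (g w c) * b c

/-- The coordinates extend by continuity and still compute the inner product. By the norm
equivalence the extension is bounded below, so its range is closed; by density it is everything. -/
theorem PreHilbertModule.IsCoordinatization.exists_completion {P : PreHilbertModule K}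
    {g : W → K → K} {ev : P.carrier →ₗ[ℂ] (W → C(K, ℂ))} (H : P.IsCoordinatization g ev)
    (hg : ∀ w, Continuous (g w)) :
    ∃ ev' : P.Completion →ₗ[ℂ] (W → C(K, ℂ)), _root_.IsCoordinatization g ev' := by
  let evL : P.carrier →L[ℂ] (W → C(K, ℂ)) := ev.mkContinuous 1 fun x => by
    rw [one_mul]
    refine (pi_norm_le_iff_of_nonneg (norm_nonneg _)).2 fun w => ?_
    rw [← pow_le_pow_iff_left₀ (norm_nonneg _) (norm_nonneg _) two_ne_zero, P.norm_sq, H.form_eq]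
    exact sq_norm_le_norm_sum_star_mul_self (ev x) w
  let evC : P.Completion →L[ℂ] (W → C(K, ℂ)) :=
    evL.extend (UniformSpace.Completion.toComplL (𝕜 := ℂ) (E := P.carrier))
  have hevC (x : P.carrier) : evC x = ev x :=
    evL.extend_eq (e := UniformSpace.Completion.toComplL (𝕜 := ℂ) (E := P.carrier))
      UniformSpace.Completion.denseRange_coe
      (UniformSpace.Completion.isUniformInducing_coe _) x
  have hinner (x y : P.Completion) :
      inner C(K, ℂ) x y = ∑ w, star (evC x w) * evC y w := by
    induction x, y using UniformSpace.Completion.induction_on₂ with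
    | hp =>
      refine isClosed_eq (P.continuous_inner_completion' continuous_fst continuous_snd) ?_
      refine continuous_finsetSum _ fun w _ => ?_
      have h1 : Continuous fun x : P.Completion => evC x w :=
        (continuous_apply w).comp evC.continuous
      exact (continuous_star.comp (h1.comp continuous_fst)).mul (h1.comp continuous_snd)
    | ih x y => rw [P.inner_coe, hevC, hevC, H.form_eq]
  have hclosed : IsClosed (Set.range evC) := by
    refine AntilipschitzWith.isClosed_range (K := Fintype.card W)
      (AddMonoidHomClass.antilipschitz_of_bound evC fun x => ?_) evC.uniformContinuous
    rw [← pow_le_pow_iff_left₀ (norm_nonneg _) (by positivity) two_ne_zero,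
      P.norm_sq_completion, hinner]
    refine (norm_sum_star_mul_self_le (evC x)).trans ?_
    gcongr
    calc ∑ w, ‖evC x w‖ ≤ ∑ _w : W, ‖evC x‖ := Finset.sum_le_sum fun w _ => norm_le_pi_norm _ w
      _ = _ := by simp
  refine ⟨evC.toLinearMap, hinner, SetLike.coe_injective (Set.Subset.antisymm ?_ ?_)⟩
  · rintro _ ⟨x, rfl⟩
    change evC x ∈ _
    induction x using UniformSpace.Completion.induction_on with
    | hp => exact (isClosed_cographFunctions g).preimage evC.continuous
    | ih x => rw [hevC]; exact H.apply_mem x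
  · refine (cographFunctions_subset_closure hg (LinearMap.range ev) fun a b => ?_).trans ?_
    · obtain ⟨x, hx⟩ := H.exists_eq a b
      exact ⟨ev x, ⟨x, rfl⟩, hx⟩
    · refine closure_minimal ?_ hclosed
      rintro _ ⟨x, rfl⟩
      exact ⟨x, hevC x⟩

end Completion

/-! ### Iterated families -/

section IterFamily

variable {K : Type*} {ι : Type*} {γ : ι → K → K} {h : K → K}

/-- The definition splits off the outermost map, whereas a new tensor factor on the right
corresponds to the innermost one. -/
theorem iterFamily_succ_eq_tail (γ : ι → K → K) (n : ℕ) (w : Fin (n + 1) → ι) :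
    iterFamily γ (n + 1) w = iterFamily γ n (Fin.tail w) ∘ γ (w 0) := by
  induction n with
  | zero => rfl
  | succ n ih =>
    change γ (w (Fin.last (n + 1))) ∘ iterFamily γ (n + 1) (Fin.init w) = _
    rw [ih, Fin.tail_init_eq_init_tail]
    rfl

theorem iterate_iterFamily (hh : ∀ j y, h (γ j y) = y) (n : ℕ) (w : Fin n → ι) (y : K) :
    h^[n] (iterFamily γ n w y) = y := by
  induction n with
  | zero => rfl
  | succ n ih =>
    rw [Function.iterate_succ_apply]
    change h^[n] (h (γ _ (iterFamily γ n (Fin.init w) y))) = y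
    rw [hh, ih]

theorem continuous_iterFamily [TopologicalSpace K] (hγ : ∀ j, Continuous (γ j)) (n : ℕ)
    (w : Fin n → ι) : Continuous (iterFamily γ n w) := by
  induction n with
  | zero => exact continuous_id
  | succ n ih => exact (hγ _).comp (ih _)

/-- If two words agree at `c`, applying `h` shows that their initial parts agree at `c`. Either
these parts differ, and `c` is a branch value of `γ^n`; or only the last letters differ, and `c` is
the image under `h^[n]` of a branch value of `γ`. -/
theorem finite_branchValueSet_iterFamily (hh : ∀ j y, h (γ j y) = y)
    (hB : (branchSet γ).Finite) (n : ℕ) : (branchValueSet (iterFamily γ n)).Finite := by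
  have hC : (branchValueSet γ).Finite := (hB.image h).subset <| by
    rintro c ⟨i, j, hij, hc⟩
    exact ⟨γ i c, ⟨c, i, j, hij, rfl, hc⟩, hh i c⟩
  induction n with
  | zero =>
    refine Set.finite_empty.subset ?_
    rintro c ⟨w, w', hw, -⟩
    exact hw (Subsingleton.elim _ _)
  | succ n ih =>
    refine (ih.union (hC.image h^[n])).subset ?_
    rintro c ⟨w, w', hw, hc⟩
    change γ _ (iterFamily γ n (Fin.init w) c) = γ _ (iterFamily γ n (Fin.init w') c) at hc
    have hd : iterFamily γ n (Fin.init w) c = iterFamily γ n (Fin.init w') c := by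
      simpa [hh] using congrArg h hc
    by_cases hinit : Fin.init w = Fin.init w'
    · refine Or.inr ⟨_, ⟨w (Fin.last n), w' (Fin.last n), fun hlast => hw ?_, ?_⟩,
        iterate_iterFamily hh n (Fin.init w) c⟩
      · rw [← Fin.snoc_init_self w, ← Fin.snoc_init_self w', hinit, hlast]
      · rw [← hd] at hc
        exact hc
    · exact Or.inl ⟨_, _, hinit, hd⟩

theorem sum_words_succ {M : Type*} [AddCommMonoid M] [Fintype ι] (n : ℕ)
    (F : (Fin (n + 1) → ι) → M) :
    ∑ w, F w = ∑ j, ∑ v : Fin n → ι, F (Fin.cons j v) := by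
  rw [← Fintype.sum_prod_type']
  exact (Equiv.sum_comp (Fin.consEquiv fun _ => ι) F).symm

end IterFamily

/-! ### Coordinates on the tensor powers of `X_γ` -/

section TensorPower

variable {K : Type u} [MetricSpace K] [CompactSpace K] {ι : Type*} [Fintype ι]

theorem isCoordinatization_coefficientModule (γ : ι → C(K, K)) :
    (coefficientModule K).IsCoordinatization (iterFamily (fun i => ⇑(γ i)) 0)
      (LinearMap.pi fun _ => (LinearMap.id : C(K, ℂ) →ₗ[ℂ] C(K, ℂ))) where
  form_eq x y := by
    rw [Fintype.sum_unique]
    rfl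
  apply_mem x c w w' _ := rfl
  exists_eq a b := ⟨a * b, fun _ _ => rfl⟩

/-- The coordinates `f ↦ (y ↦ f (γ_w y, y))` on `X_γ`. -/
noncomputable def cographCoordinates (γ : ι → C(K, K)) :
    C(cograph γ, ℂ) →ₗ[ℂ] ((Fin 1 → ι) → C(K, ℂ)) where
  toFun f w := f.comp (cographMk γ (w 0))
  map_add' _ _ := rfl
  map_smul' _ _ := rfl

theorem cographMk_eq {γ : ι → C(K, K)} {i j : ι} {y : K} (hij : γ i y = γ j y) :
    cographMk γ i y = cographMk γ j y := Subtype.ext (Prod.ext hij rfl)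

theorem isCoordinatization_selfSimilarModule (γ : ι → C(K, K)) :
    (selfSimilarModule γ).IsCoordinatization (iterFamily (fun i => ⇑(γ i)) 1)
      (cographCoordinates γ) where
  form_eq f f' := by
    rw [sum_words_succ]
    simp only [Fintype.sum_unique]
    ext y
    refine (selfSimilarForm_apply γ f f' y).trans ?_
    simp only [ContinuousMap.coe_sum, Finset.sum_apply]
    rfl
  apply_mem f c w w' hw := by
    have hw' : cographMk γ (w 0) c = cographMk γ (w' 0) c := cographMk_eq hw
    exact congrArg (fun p => (show C(cograph γ, ℂ) from f) p) hw'
  exists_eq a b := ⟨a.comp (cographFst γ) * b.comp (cographSnd γ), fun _ _ => rfl⟩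

/-- The coordinates on `P ⊗ X_γ` obtained from coordinates on `P`. -/
noncomputable def tensorCoordinates {n : ℕ} {P : PreHilbertModule K} (γ : ι → C(K, K))
    (ev : P.carrier →ₗ[ℂ] ((Fin n → ι) → C(K, ℂ))) :
    P.carrier ⊗[ℂ] C(cograph γ, ℂ) →ₗ[ℂ] ((Fin (n + 1) → ι) → C(K, ℂ)) :=
  TensorProduct.lift <| LinearMap.mk₂ ℂ
    (fun s f w => (ev s (Fin.tail w)).comp (γ (w 0)) * f.comp (cographMk γ (w 0)))
    (fun s s' f => by ext; simp [add_mul])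
    (fun r s f => by ext; simp)
    (fun s f f' => by ext; simp [mul_add])
    (fun r s f => by ext; simp)

/-- Slices reduce statements about arbitrary tensors to statements about single vectors of `P`, as
in `tensorForm_apply`. -/
theorem tensorCoordinates_apply {n : ℕ} {P : PreHilbertModule K} (γ : ι → C(K, K))
    (ev : P.carrier →ₗ[ℂ] ((Fin n → ι) → C(K, ℂ))) (x : P.carrier ⊗[ℂ] C(cograph γ, ℂ))
    (w : Fin (n + 1) → ι) (y : K) :
    tensorCoordinates γ ev x w y =
      ev (tensorSlice P γ (w 0) y x) (Fin.tail w) (γ (w 0) y) := by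
  induction x using TensorProduct.induction_on with
  | zero => simp
  | add x x' hx hx' =>
    simp only [map_add, Pi.add_apply, ContinuousMap.add_apply, hx, hx']
  | tmul s f =>
    change ev s (Fin.tail w) (γ (w 0) y) * f (cographMk γ (w 0) y) =
      ev (f (cographMk γ (w 0) y) • s) (Fin.tail w) (γ (w 0) y)
    rw [map_smul]
    exact mul_comm _ _

theorem tensorSlice_eq {P : PreHilbertModule K} {γ : ι → C(K, K)} {i j : ι} {y : K}
    (hij : γ i y = γ j y) : tensorSlice P γ i y = tensorSlice P γ j y :=
  TensorProduct.ext' fun s f => by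
    change f (cographMk γ i y) • s = f (cographMk γ j y) • s
    rw [cographMk_eq hij]

/-- The form of `P ⊗ X_γ` at `y` sums the form of `P` over the slices at the points `γ_j(y)`;
expanding the latter over words of length `n` gives the sum over words of length `n + 1`. -/
theorem PreHilbertModule.IsCoordinatization.innerTensor {n : ℕ} {P : PreHilbertModule K}
    {γ : ι → C(K, K)} {h : K → K} (hh : ∀ j y, h (γ j y) = y)
    {ev : P.carrier →ₗ[ℂ] ((Fin n → ι) → C(K, ℂ))}
    (H : P.IsCoordinatization (iterFamily (fun i => ⇑(γ i)) n) ev) :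
    (innerTensor P γ).IsCoordinatization (iterFamily (fun i => ⇑(γ i)) (n + 1))
      (tensorCoordinates γ ev) where
  form_eq x z := by
    ext y
    refine (tensorForm_apply P γ x z y).trans ?_
    rw [sum_words_succ]
    simp only [ContinuousMap.coe_sum, Finset.sum_apply, H.form_eq]
    refine Finset.sum_congr rfl fun j _ => Finset.sum_congr rfl fun v _ => ?_
    exact (congrArg₂ (fun a b : ℂ => star a * b) (tensorCoordinates_apply γ ev x (Fin.cons j v) y)
      (tensorCoordinates_apply γ ev z (Fin.cons j v) y)).symm
  apply_mem x c w w' hw := by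
    rw [iterFamily_succ_eq_tail, iterFamily_succ_eq_tail] at hw
    -- Applying `h^[n]` cancels the tails, so the first letters already agree at `c` and the two
    -- slices coincide.
    have hc : γ (w 0) c = γ (w' 0) c := by
      simpa [iterate_iterFamily hh] using congrArg h^[n] hw
    refine (tensorCoordinates_apply γ ev x w c).trans
      (Eq.trans ?_ (tensorCoordinates_apply γ ev x w' c).symm)
    rw [tensorSlice_eq hc, ← hc]
    refine H.apply_mem _ _ _ _ ?_
    simpa [← hc] using hw
  exists_eq a b := by
    -- The factor in `P` carries `a`, evaluated at the end of the word; `b` sits in the factor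
    -- `X_γ`, evaluated at the starting point.
    obtain ⟨s, hs⟩ := H.exists_eq a 1
    refine ⟨s ⊗ₜ b.comp (cographSnd γ), fun w c => ?_⟩
    rw [iterFamily_succ_eq_tail]
    change ev s (Fin.tail w) (γ (w 0) c) * b c = _
    simp [hs]

theorem exists_isCoordinatization_preTensorPower {γ : ι → C(K, K)} {h : K → K}
    (hh : ∀ j y, h (γ j y) = y) : ∀ n : ℕ,
    ∃ ev, (preTensorPower γ n).IsCoordinatization (iterFamily (fun i => ⇑(γ i)) n) ev
  | 0 => ⟨_, isCoordinatization_coefficientModule γ⟩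
  | 1 => ⟨_, isCoordinatization_selfSimilarModule γ⟩
  | n + 2 => by
    obtain ⟨ev, H⟩ := exists_isCoordinatization_preTensorPower hh (n + 1)
    exact ⟨_, H.innerTensor hh⟩

end TensorPower

theorem mainTheorem5 {K : Type u} [MetricSpace K] [CompactSpace K] {N : ℕ} (hN : 2 ≤ N)
    (γ : Fin N → C(K, K)) (hγ : IsSelfSimilar γ)
    (h : K → K) (hB : AssumptionB (fun i => ⇑(γ i)) h) (n : ℕ) :
    finiteRankOperators C(K, ℂ) (selfSimilarPower γ n) =
        (compactOperators C(K, ℂ) (selfSimilarPower γ n) :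
          Set (AdjointableOp C(K, ℂ) (selfSimilarPower γ n))) ∧
      IsClosed (degenerateAlgebra (iterFamily (fun i => ⇑(γ i)) n) h^[n] :
          Set (CStarMatrix (Fin n → Fin N) (Fin n → Fin N) C(K, ℂ))) ∧
      Nonempty (compactOperators C(K, ℂ) (selfSimilarPower γ n) ≃⋆ₐ[ℂ]
        degenerateAlgebra (iterFamily (fun i => ⇑(γ i)) n) h^[n]) := by
  obtain ⟨ev, H⟩ := exists_isCoordinatization_preTensorPower hB.leftInverse n
  obtain ⟨ev', H'⟩ := H.exists_completion
    (continuous_iterFamily (fun i => (γ i).continuous) n)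
  have hg := iterate_iterFamily hB.leftInverse n
  have hC := finite_branchValueSet_iterFamily hB.leftInverse hB.finite_branchSet n
  exact ⟨(H'.finiteRankOperators_eq_range hg hC).trans (H'.compactOperators_eq_range hg hC).symm,
    isClosed_degenerateAlgebra _ _, ⟨H'.compactOperatorsEquiv hg hC⟩⟩
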